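/- Let $U\subseteq\mathbb R^n$ be open, with coordinates $q=(q^1,\dots,q^n)$. Let $\gamma_{ab}(q)$ be a smooth symmetric nondegenerate matrix function on $U$ (the kinetic metric, of any signature), with connection coefficients $\Gamma^a_{bc}$, and let $V(q)$ be a smooth potential on $U$. Consider the autonomous conservative dynamical system $$\ddot q^a=-\Gamma^a_{bc}\dot q^b\dot q^c-V^{,a}.\qquad(*)$$ Indices are raised and lowered with $\gamma_{ab}$, a comma denotes a partial derivative, a semicolon the covariant derivative of $\gamma_{ab}$, round brackets symmetrization, and repeated indices are summed. A Killing tensor (KT) is a smooth symmetric tensor field $C_{ab}$ on $U$ with $C_{(ab;c)}=0$. Let $T\subseteq\mathbb R$ be a nonempty open interval. A function $I(t,q,\dot q)$, real- or complex-valued, is a first integral on $T$ if $dI/dt=0$ along every solution of $(*)$ in $U$ defined on an open subset of $T$. All fields $C_{ab},L_a,B_a$ and functions $G(q)$ below are real and smooth on $U$. Consider three types of functions. **Type 1.** $I_1=-\frac{t^2}{2}L_{(a;b)}\dot q^a\dot q^b+C_{ab}\dot q^a\dot q^b+tL_a\dot q^a+\frac{t^2}{2}L_aV^{,a}+G(q)$,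 where $C_{ab}$ and $L_{(a;b)}$ are KTs, $(L_bV^{,b})_{,a}=-2L_{(a;b)}V^{,b}$ and $G_{,a}=2C_{ab}V^{,b}-L_a$. **Type 2.** $I_2=-\frac{t^3}{3}L_{(a;b)}\dot q^a\dot q^b+t^2L_a\dot q^a+\frac{t^3}{3}L_aV^{,a}-tB_{(a;b)}\dot q^a\dot q^b+B_a\dot q^a+tB_aV^{,a}$, where $L_{(a;b)}$ and $B_{(a;b)}$ are KTs, $(L_bV^{,b})_{,a}=-2L_{(a;b)}V^{,b}$ and $(B_bV^{,b})_{,a}=-2B_{(a;b)}V^{,b}-2L_a$. **Type 3.** $I_3=I_3(\lambda,L)=-e^{\lambda t}L_{(a;b)}\dot q^a\dot q^b+\lambda e^{\lambda t}L_a\dot q^a+e^{\lambda t}L_aV^{,a}$, where $\lambda\in\mathbb C$, $\lambda\ne0$, $L_{(a;b)}$ is a KT and $(L_bV^{,b})_{,a}=-2L_{(a;b)}V^{,b}-\lambda^2L_a$. Then: 1. All functions of types 1, 2 and 3 are first integrals on $T$. 2. Let $g,f$ be real analytic functions on $T$, $C_{ab}$ a KT, $L_a,B_a$ smooth covector fields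 on $U$ and $K(t,q)$ a smooth function on $T\times U$, such that $$I=g(t)C_{ab}\dot q^a\dot q^b+\bigl(f(t)L_a+B_a\bigr)\dot q^a+K(t,q)$$ is a first integral on $T$. Then there are an $I_1$ of type 1, an $I_2$ of type 2, a number $\lambda\neq0$ that is real or purely imaginary, a covector field $L'_a$ for which $I_3(\lambda,L')$ and $I_3(-\lambda,L')$ are both of type 3, and $\alpha,\beta\in\mathbb C$ such that on $T\times U\times\mathbb R^n$ $$I=I_1+I_2+\alpha I_3(\lambda,L')+\beta I_3(-\lambda,L').$$ Here $\alpha,\beta$ are real if $\lambda$ is real, or else $\lambda$ is imaginary and $\beta=\bar\alpha$. 3. The types are linearly independent: if $I_1$ is of type 1, $I_2$ is of type 2, and $I_3(\lambda_j,L^{(j)})$, $j=1,\dots,r$, are of type 3 with distinct $\lambda_j$, and $I_1+I_2+\sum_j\alpha_jI_3(\lambda_j,L^{(j)})=0$ on $T\times U\times\mathbb R^n$ with $\alpha_j\in\mathbb C$, then $I_1$, $I_2$ and each $\alpha_jI_3(\lambda_j,L^{(j)})$ vanish there. -/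

import Mathlib

open scoped ContDiff

noncomputable section

/-- The partial derivative `F_{,a}` of a scalar function of the coordinates `q`. -/
def pderivCoord {n : ℕ} (a : Fin n) (F : (Fin n → ℝ) → ℝ) (q : Fin n → ℝ) : ℝ :=
  fderiv ℝ F q (Pi.single a 1)

/-- An autonomous conservative dynamical system with `n` degrees of freedom, in coordinates
`q` ranging over an open set `U` of `ℝⁿ`: a smooth kinetic metric `γ_{ab}(q)`, symmetric and
nondegenerate (of any signature), and a smooth potential `V(q)`. -/
structure ConservativeSystem (n : ℕ) where
  U : Set (Fin n → ℝ)
  isOpen_U : IsOpen U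
  γ : (Fin n → ℝ) → Matrix (Fin n) (Fin n) ℝ
  γ_smooth : ∀ a b, ContDiffOn ℝ ∞ (fun q => γ q a b) U
  γ_symm : ∀ q ∈ U, (γ q).IsSymm
  γ_regular : ∀ q ∈ U, (γ q).det ≠ 0
  V : (Fin n → ℝ) → ℝ
  V_smooth : ContDiffOn ℝ ∞ V U

namespace ConservativeSystem

variable {n : ℕ}

/-- The connection coefficients `Γ^a_{bc}` of the kinetic metric. -/
def christoffel (S : ConservativeSystem n) (a b c : Fin n) (q : Fin n → ℝ) : ℝ :=
  (1 / 2) * ∑ d, (S.γ q)⁻¹ a d *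
    (pderivCoord b (fun x => S.γ x d c) q + pderivCoord c (fun x => S.γ x d b) q
      - pderivCoord d (fun x => S.γ x b c) q)

/-- The raised gradient `V^{,a} = γ^{ab} V_{,b}` of the potential. -/
def gradV (S : ConservativeSystem n) (q : Fin n → ℝ) (a : Fin n) : ℝ :=
  ∑ b, (S.γ q)⁻¹ a b * pderivCoord b S.V q

/-- The acceleration `-Γ^a_{bc} v^b v^c - V^{,a}` prescribed by the dynamical equations. -/
def accel (S : ConservativeSystem n) (q v : Fin n → ℝ) (a : Fin n) : ℝ :=
  -(∑ b, ∑ c, S.christoffel a b c q * v b * v c) - S.gradV q a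

/-- `q` is a solution on `J`, with velocity `v`, of
`q̈^a = -Γ^a_{bc} q̇^b q̇^c - V^{,a}`. -/
def IsSolution (S : ConservativeSystem n) (J : Set ℝ) (q v : ℝ → Fin n → ℝ) : Prop :=
  ∀ t ∈ J, q t ∈ S.U ∧ HasDerivAt q (v t) t ∧ HasDerivAt v (S.accel (q t) (v t)) t

/-- A (real- or complex-valued) function `I(t, q, q̇)` is a first integral for times in `T`:
`dI/dt = 0` along every solution, where solutions need only be local in time. -/
def IsFirstIntegral {F : Type*} [NormedAddCommGroup F] [NormedSpace ℝ F]
    (S : ConservativeSystem n) (T : Set ℝ)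
    (I : ℝ → (Fin n → ℝ) → (Fin n → ℝ) → F) : Prop :=
  ∀ J : Set ℝ, IsOpen J → J ⊆ T → ∀ q v : ℝ → Fin n → ℝ, S.IsSolution J q v →
    ∀ t ∈ J, HasDerivAt (fun s => I s (q s) (v s)) 0 t

/-- A smooth covector field `L_a(q)` on the configuration space. -/
def IsCovectorField (S : ConservativeSystem n) (L : (Fin n → ℝ) → Fin n → ℝ) : Prop :=
  ∀ a, ContDiffOn ℝ ∞ (fun q => L q a) S.U

/-- The covariant derivative `L_{a;b}`. -/
def covDeriv₁ (S : ConservativeSystem n) (L : (Fin n → ℝ) → Fin n → ℝ)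
    (q : Fin n → ℝ) (a b : Fin n) : ℝ :=
  pderivCoord b (fun x => L x a) q - ∑ c, S.christoffel c a b q * L q c

/-- The symmetrized covariant derivative `L_{(a;b)}`. -/
def symCovDeriv (S : ConservativeSystem n) (L : (Fin n → ℝ) → Fin n → ℝ)
    (q : Fin n → ℝ) (a b : Fin n) : ℝ :=
  (1 / 2) * (S.covDeriv₁ L q a b + S.covDeriv₁ L q b a)

/-- The covariant derivative `C_{ab;c}`. -/
def covDeriv₂ (S : ConservativeSystem n) (C : (Fin n → ℝ) → Fin n → Fin n → ℝ)
    (q : Fin n → ℝ) (a b c : Fin n) : ℝ :=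
  pderivCoord c (fun x => C x a b) q
    - ∑ d, S.christoffel d a c q * C q d b - ∑ d, S.christoffel d b c q * C q a d

/-- A Killing tensor of order 2 of the kinetic metric: a smooth symmetric tensor field
`C_{ab}` with `C_{(ab;c)} = 0`. -/
def IsKillingTensor (S : ConservativeSystem n)
    (C : (Fin n → ℝ) → Fin n → Fin n → ℝ) : Prop :=
  (∀ a b, ContDiffOn ℝ ∞ (fun q => C q a b) S.U) ∧
  (∀ q ∈ S.U, ∀ a b, C q a b = C q b a) ∧
  (∀ q ∈ S.U, ∀ a b c,
    S.covDeriv₂ C q a b c + S.covDeriv₂ C q b c a + S.covDeriv₂ C q c a b = 0)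

/-- The contraction `L_a V^{,a}`, a function of `q`. -/
def alongV (S : ConservativeSystem n) (L : (Fin n → ℝ) → Fin n → ℝ) (q : Fin n → ℝ) : ℝ :=
  ∑ a, L q a * S.gradV q a

/-- The covector `C_{ab} V^{,b}`. -/
def contractV (S : ConservativeSystem n) (C : (Fin n → ℝ) → Fin n → Fin n → ℝ)
    (q : Fin n → ℝ) (a : Fin n) : ℝ :=
  ∑ b, C q a b * S.gradV q b

end ConservativeSystem

/-- The linear form `L_a v^a`. -/
def linForm {n : ℕ} (L v : Fin n → ℝ) : ℝ := ∑ a, L a * v a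

/-- The quadratic form `C_{ab} v^a v^b`. -/
def quadForm {n : ℕ} (C : Fin n → Fin n → ℝ) (v : Fin n → ℝ) : ℝ :=
  ∑ a, ∑ b, C a b * v a * v b

namespace ConservativeSystem

variable {n : ℕ}

/-- The conditions on `C_{ab}`, `L_a`, `G` in the first type of first integral. -/
structure IsData₁ (S : ConservativeSystem n) (C : (Fin n → ℝ) → Fin n → Fin n → ℝ)
    (L : (Fin n → ℝ) → Fin n → ℝ) (G : (Fin n → ℝ) → ℝ) : Prop where
  L_smooth : S.IsCovectorField L
  G_smooth : ContDiffOn ℝ ∞ G S.U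
  C_killing : S.IsKillingTensor C
  L_killing : S.IsKillingTensor (S.symCovDeriv L)
  L_constraint : ∀ q ∈ S.U, ∀ a,
    pderivCoord a (S.alongV L) q = -2 * S.contractV (S.symCovDeriv L) q a
  G_constraint : ∀ q ∈ S.U, ∀ a, pderivCoord a G q = 2 * S.contractV C q a - L q a

/-- The first type of quadratic first integral. -/
def I₁ (S : ConservativeSystem n) (C : (Fin n → ℝ) → Fin n → Fin n → ℝ)
    (L : (Fin n → ℝ) → Fin n → ℝ) (G : (Fin n → ℝ) → ℝ)
    (t : ℝ) (q v : Fin n → ℝ) : ℝ :=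
  -(t ^ 2 / 2) * quadForm (S.symCovDeriv L q) v + quadForm (C q) v + t * linForm (L q) v
    + t ^ 2 / 2 * S.alongV L q + G q

/-- The conditions on `L_a`, `B_a` in the second type of first integral. -/
structure IsData₂ (S : ConservativeSystem n) (L B : (Fin n → ℝ) → Fin n → ℝ) : Prop where
  L_smooth : S.IsCovectorField L
  B_smooth : S.IsCovectorField B
  L_killing : S.IsKillingTensor (S.symCovDeriv L)
  B_killing : S.IsKillingTensor (S.symCovDeriv B)
  L_constraint : ∀ q ∈ S.U, ∀ a,
    pderivCoord a (S.alongV L) q = -2 * S.contractV (S.symCovDeriv L) q a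
  B_constraint : ∀ q ∈ S.U, ∀ a,
    pderivCoord a (S.alongV B) q = -2 * S.contractV (S.symCovDeriv B) q a - 2 * L q a

/-- The second type of quadratic first integral. -/
def I₂ (S : ConservativeSystem n) (L B : (Fin n → ℝ) → Fin n → ℝ)
    (t : ℝ) (q v : Fin n → ℝ) : ℝ :=
  -(t ^ 3 / 3) * quadForm (S.symCovDeriv L q) v + t ^ 2 * linForm (L q) v
    + t ^ 3 / 3 * S.alongV L q - t * quadForm (S.symCovDeriv B q) v
    + linForm (B q) v + t * S.alongV B q

/-- The conditions on `λ` and `L_a` in the third type of first integral. The constant `l`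
stands for `λ`; it may be complex, but `L_a` is real, so that `λ²` is real unless `L_a = 0`. -/
structure IsData₃ (S : ConservativeSystem n) (l : ℂ) (L : (Fin n → ℝ) → Fin n → ℝ) :
    Prop where
  l_ne_zero : l ≠ 0
  L_smooth : S.IsCovectorField L
  L_killing : S.IsKillingTensor (S.symCovDeriv L)
  L_constraint : ∀ q ∈ S.U, ∀ a,
    ((pderivCoord a (S.alongV L) q : ℝ) : ℂ) =
      -2 * ((S.contractV (S.symCovDeriv L) q a : ℝ) : ℂ) - l ^ 2 * ((L q a : ℝ) : ℂ)

/-- The third type of quadratic first integral (real-valued when `λ` is real). -/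
def I₃ (S : ConservativeSystem n) (l : ℂ) (L : (Fin n → ℝ) → Fin n → ℝ)
    (t : ℝ) (q v : Fin n → ℝ) : ℂ :=
  -Complex.exp (l * t) * ((quadForm (S.symCovDeriv L q) v : ℝ) : ℂ)
    + l * Complex.exp (l * t) * ((linForm (L q) v : ℝ) : ℂ)
    + Complex.exp (l * t) * ((S.alongV L q : ℝ) : ℂ)

/-- The function `I = g(t) C_{ab} v^a v^b + (f(t) L_a + B_a) v^a + K(t, q)`. -/
def ansatz (g f : ℝ → ℝ) (C : (Fin n → ℝ) → Fin n → Fin n → ℝ)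
    (L B : (Fin n → ℝ) → Fin n → ℝ) (K : ℝ → (Fin n → ℝ) → ℝ)
    (t : ℝ) (q v : Fin n → ℝ) : ℝ :=
  g t * quadForm (C q) v + (f t * linForm (L q) v + linForm (B q) v) + K t q

end ConservativeSystem

end

/-! Along a solution, the derivative of a function quadratic in the velocity is a polynomial of
degree at most three in the velocity. The connection terms of the acceleration turn partial
derivatives into covariant ones (`hasDerivAt_linForm`, `hasDerivAt_quadForm`), and the cubic part
vanishes for Killing tensors. For the three types the constraints cancel everything that remains.

Conversely, a local solution passes through every (t, q, v) (`exists_isSolution`), so each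
homogeneous part of dI/dt vanishes separately; this gives `DeterminingEquations`. Its equations for
K_{,a} and K_t are compatible only if f'' L_a + f E_a + F_a = 0, where E_a = (L_b V^{,b})_{,a} + 2
L_(a;b) V^{,b} and F_a is the same expression in B (`DeterminingEquations.integrability`). The
coefficients depend on q alone, so this is a linear relation between the functions f'', f, 1. If f
is constant, or if f'', f, 1 are independent (hence L = 0), the linear part of I is static.
Otherwise f'' = a f + b, E = -a L and F = -b L, and the same dichotomy for g' makes L_(a;b) and
B_(a;b) Killing tensors.

For a primitive p of f, the fields g C_{ab} + p L_(a;b) + t B_(a;b) and K - p L_a V^{,a} - t B_a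
V^{,a} do not depend on t (`DeterminingEquations.exists_static_parts`), so all time dependence of I
sits in f, p and t. If a = 0, then f is a polynomial of degree at most two and its coefficients
distribute over types 1 and 2. If a ≠ 0, then p + (b/a) t is a combination of exp(λt) and exp(-λt)
with λ² = a, which yields the pair of type 3.

For independence, fix q and v: exponentials separate from cubic polynomials in t, then the powers of
t separate, and finally parity in v separates types 1 and 2 within each power. -/

section Forms

/-! ### Linear and quadratic forms in the velocity; partial derivatives -/

variable {n : ℕ}

lemma linForm_add (L M v : Fin n → ℝ) :
    linForm (fun a => L a + M a) v = linForm L v + linForm M v := by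
  simp only [linForm, add_mul, Finset.sum_add_distrib]

lemma linForm_smul (c : ℝ) (L v : Fin n → ℝ) :
    linForm (fun a => c * L a) v = c * linForm L v := by
  simp only [linForm, Finset.mul_sum, mul_assoc]

lemma linForm_zero_right (L : Fin n → ℝ) : linForm L 0 = 0 := by simp [linForm]

lemma linForm_neg_right (L v : Fin n → ℝ) : linForm L (-v) = -linForm L v := by
  simp [linForm]

lemma linForm_single (L : Fin n → ℝ) (a : Fin n) : linForm L (Pi.single a 1) = L a := by
  simp [linForm, Pi.single_apply]

lemma quadForm_add (C D : Fin n → Fin n → ℝ) (v : Fin n → ℝ) :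
    quadForm (fun a b => C a b + D a b) v = quadForm C v + quadForm D v := by
  simp only [quadForm, add_mul, Finset.sum_add_distrib]

lemma quadForm_smul (c : ℝ) (C : Fin n → Fin n → ℝ) (v : Fin n → ℝ) :
    quadForm (fun a b => c * C a b) v = c * quadForm C v := by
  simp only [quadForm, Finset.mul_sum, mul_assoc]

lemma quadForm_zero_right (C : Fin n → Fin n → ℝ) : quadForm C 0 = 0 := by simp [quadForm]

lemma quadForm_neg_right (C : Fin n → Fin n → ℝ) (v : Fin n → ℝ) :
    quadForm C (-v) = quadForm C v := by
  simp [quadForm]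

lemma quadForm_add_single (C : Fin n → Fin n → ℝ) (a b : Fin n) :
    quadForm C (Pi.single a 1 + Pi.single b 1) = C a a + C a b + C b a + C b b := by
  simp only [quadForm, Pi.add_apply, Pi.single_apply, mul_add, add_mul, Finset.sum_add_distrib]
  simp
  ring

lemma quadForm_single (C : Fin n → Fin n → ℝ) (a : Fin n) :
    quadForm C (Pi.single a 1) = C a a := by
  simp [quadForm, Pi.single_apply]

/-- Polarization, tested on basis vectors and their pairwise sums. -/
lemma eq_zero_of_quadForm_eq_zero {C : Fin n → Fin n → ℝ} (hC : ∀ a b, C a b = C b a)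
    (h : ∀ v, quadForm C v = 0) (a b : Fin n) : C a b = 0 := by
  have h1 := h (Pi.single a 1 + Pi.single b 1)
  rw [quadForm_add_single] at h1
  have h2 := h (Pi.single a 1)
  have h3 := h (Pi.single b 1)
  rw [quadForm_single] at h2 h3
  linarith [hC a b]

/-- A polynomial of degree two in the velocity vanishes only if each homogeneous part does. -/
lemma forms_eq_zero {Q : Fin n → Fin n → ℝ} {L : Fin n → ℝ} {c : ℝ}
    (h : ∀ v, quadForm Q v + linForm L v + c = 0) :
    (∀ v, quadForm Q v = 0) ∧ (∀ v, linForm L v = 0) ∧ c = 0 := by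
  have hc : c = 0 := by simpa [quadForm_zero_right, linForm_zero_right] using h 0
  have hv : ∀ v, quadForm Q v = 0 ∧ linForm L v = 0 := by
    intro v
    have h1 := h v
    have h2 := h (-v)
    rw [quadForm_neg_right, linForm_neg_right] at h2
    constructor <;> linarith
  exact ⟨fun v => (hv v).1, fun v => (hv v).2, hc⟩

lemma fderiv_eq_linForm (F : (Fin n → ℝ) → ℝ) (q v : Fin n → ℝ) :
    fderiv ℝ F q v = linForm (fun a => pderivCoord a F q) v := by
  conv_lhs => rw [← Finset.univ_sum_single v]
  rw [map_sum]
  refine Finset.sum_congr rfl fun a _ => ?_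
  have : (Pi.single a (v a) : Fin n → ℝ) = v a • Pi.single a 1 := by
    rw [← Pi.single_smul]; simp
  rw [this, map_smul, smul_eq_mul, mul_comm]
  rfl

lemma hasDerivAt_comp_path {F : (Fin n → ℝ) → ℝ} {q v : ℝ → Fin n → ℝ} {t : ℝ}
    (hF : DifferentiableAt ℝ F (q t)) (hq : HasDerivAt q (v t) t) :
    HasDerivAt (fun s => F (q s)) (linForm (fun a => pderivCoord a F (q t)) (v t)) t := by
  have := hF.hasFDerivAt.comp_hasDerivAt t hq
  rwa [fderiv_eq_linForm] at this

lemma pderivCoord_congr {U : Set (Fin n → ℝ)} (hU : IsOpen U) {F F' : (Fin n → ℝ) → ℝ}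
    (h : ∀ q ∈ U, F q = F' q) {q : Fin n → ℝ} (hq : q ∈ U) (a : Fin n) :
    pderivCoord a F q = pderivCoord a F' q := by
  have : F =ᶠ[nhds q] F' := Filter.eventuallyEq_of_mem (hU.mem_nhds hq) h
  rw [pderivCoord, pderivCoord, this.fderiv_eq]

lemma pderivCoord_add {F F' : (Fin n → ℝ) → ℝ} {q : Fin n → ℝ} (hF : DifferentiableAt ℝ F q)
    (hF' : DifferentiableAt ℝ F' q) (a : Fin n) :
    pderivCoord a (fun x => F x + F' x) q = pderivCoord a F q + pderivCoord a F' q := by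
  simp only [pderivCoord]
  rw [fderiv_fun_add hF hF']
  rfl

lemma pderivCoord_smul (c : ℝ) (F : (Fin n → ℝ) → ℝ) (q : Fin n → ℝ) (a : Fin n) :
    pderivCoord a (fun x => c * F x) q = c * pderivCoord a F q := by
  simp only [pderivCoord]
  have := fderiv_const_smul_field (𝕜 := ℝ) (f := F) c
  have h2 := congrFun this q
  change fderiv ℝ (c • F) q _ = _
  rw [h2]
  rfl

lemma contDiffOn_pderivCoord {U : Set (Fin n → ℝ)} (hU : IsOpen U) {F : (Fin n → ℝ) → ℝ}
    (hF : ContDiffOn ℝ ∞ F U) (a : Fin n) : ContDiffOn ℝ ∞ (pderivCoord a F) U :=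
  (hF.fderiv_of_isOpen hU (by simp)).clm_apply contDiffOn_const

end Forms

/-! ### Smoothness and linearity of the tensor operations -/

lemma contDiffOn_matrix_det {n : ℕ} {E : Type*} [NormedAddCommGroup E] [NormedSpace ℝ E] {s : Set E}
    {M : E → Matrix (Fin n) (Fin n) ℝ} (hM : ∀ a b, ContDiffOn ℝ ∞ (fun x => M x a b) s) :
    ContDiffOn ℝ ∞ (fun x => (M x).det) s := by
  simp only [Matrix.det_apply]
  exact ContDiffOn.sum fun σ _ => (contDiffOn_prod fun i _ => hM _ _).const_smul _

/-- Cramer's rule: the entries of the adjugate are themselves determinants of matrices with smooth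
entries. -/
lemma contDiffOn_matrix_inv {n : ℕ} {E : Type*} [NormedAddCommGroup E] [NormedSpace ℝ E]
    {s : Set E} {M : E → Matrix (Fin n) (Fin n) ℝ}
    (hM : ∀ a b, ContDiffOn ℝ ∞ (fun x => M x a b) s) (hdet : ∀ x ∈ s, (M x).det ≠ 0)
    (a b : Fin n) : ContDiffOn ℝ ∞ (fun x => (M x)⁻¹ a b) s := by
  have h : ContDiffOn ℝ ∞ (fun x => (M x).det⁻¹ * (M x).adjugate a b) s := by
    refine ((contDiffOn_matrix_det hM).inv hdet).mul ?_
    simp only [Matrix.adjugate_apply]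
    refine contDiffOn_matrix_det fun i j => ?_
    simp only [Matrix.updateRow_apply]
    split_ifs
    · exact contDiffOn_const
    · exact hM i j
  refine h.congr fun x _ => ?_
  rw [Matrix.inv_def, Ring.inverse_eq_inv']
  rfl

lemma sum_rotate {ι : Type*} [Fintype ι] (F : ι → ι → ι → ℝ) :
    ∑ a, ∑ b, ∑ c, F a b c = ∑ c, ∑ a, ∑ b, F a b c := by
  rw [Finset.sum_comm (s := (Finset.univ : Finset ι)) (f := fun c a => ∑ b, F a b c)]
  exact Finset.sum_congr rfl fun a _ => Finset.sum_comm

namespace ConservativeSystem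

variable {n : ℕ} (S : ConservativeSystem n)

section Smoothness

variable {S}

lemma differentiableAt {F : (Fin n → ℝ) → ℝ} (hF : ContDiffOn ℝ ∞ F S.U) {q : Fin n → ℝ}
    (hq : q ∈ S.U) : DifferentiableAt ℝ F q :=
  ((hF.differentiableOn (by simp)) q hq).differentiableAt (S.isOpen_U.mem_nhds hq)

variable (S)

lemma gradV_smooth (a : Fin n) : ContDiffOn ℝ ∞ (fun q => S.gradV q a) S.U :=
  ContDiffOn.sum fun b _ => (contDiffOn_matrix_inv S.γ_smooth S.γ_regular a b).mul
    (contDiffOn_pderivCoord S.isOpen_U S.V_smooth b)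

lemma christoffel_smooth (a b c : Fin n) : ContDiffOn ℝ ∞ (S.christoffel a b c) S.U :=
  contDiffOn_const.mul <| ContDiffOn.sum fun d _ =>
    (contDiffOn_matrix_inv S.γ_smooth S.γ_regular a d).mul <|
      ((contDiffOn_pderivCoord S.isOpen_U (S.γ_smooth d c) b).add
        (contDiffOn_pderivCoord S.isOpen_U (S.γ_smooth d b) c)).sub
        (contDiffOn_pderivCoord S.isOpen_U (S.γ_smooth b c) d)

variable {S}

lemma alongV_smooth {L : (Fin n → ℝ) → Fin n → ℝ} (hL : S.IsCovectorField L) :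
    ContDiffOn ℝ ∞ (S.alongV L) S.U :=
  ContDiffOn.sum fun a _ => (hL a).mul (S.gradV_smooth a)

end Smoothness

section Linearity

variable {S}

lemma alongV_add (L M : (Fin n → ℝ) → Fin n → ℝ) (q : Fin n → ℝ) :
    S.alongV (fun q a => L q a + M q a) q = S.alongV L q + S.alongV M q := by
  simp only [alongV, add_mul, Finset.sum_add_distrib]

lemma alongV_smul (c : ℝ) (L : (Fin n → ℝ) → Fin n → ℝ) (q : Fin n → ℝ) :
    S.alongV (fun q a => c * L q a) q = c * S.alongV L q := by
  simp only [alongV, Finset.mul_sum, mul_assoc]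

lemma alongV_zero : S.alongV (fun _ _ => 0) = fun _ => 0 := by
  funext q
  simp [alongV]

lemma contractV_add (C D : (Fin n → ℝ) → Fin n → Fin n → ℝ) (q : Fin n → ℝ) (a : Fin n) :
    S.contractV (fun q a b => C q a b + D q a b) q a = S.contractV C q a + S.contractV D q a := by
  simp only [contractV, add_mul, Finset.sum_add_distrib]

lemma contractV_smul (c : ℝ) (C : (Fin n → ℝ) → Fin n → Fin n → ℝ) (q : Fin n → ℝ)
    (a : Fin n) :
    S.contractV (fun q a b => c * C q a b) q a = c * S.contractV C q a := by
  simp only [contractV, Finset.mul_sum, mul_assoc]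

lemma contractV_congr {C D : (Fin n → ℝ) → Fin n → Fin n → ℝ} {q : Fin n → ℝ}
    (h : ∀ a b, C q a b = D q a b) (a : Fin n) : S.contractV C q a = S.contractV D q a := by
  simp only [contractV, h]

lemma symCovDeriv_add {L M : (Fin n → ℝ) → Fin n → ℝ} (hL : S.IsCovectorField L)
    (hM : S.IsCovectorField M) {q : Fin n → ℝ} (hq : q ∈ S.U) (a b : Fin n) :
    S.symCovDeriv (fun q a => L q a + M q a) q a b
      = S.symCovDeriv L q a b + S.symCovDeriv M q a b := by
  simp only [symCovDeriv, covDeriv₁, mul_add, Finset.sum_add_distrib]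
  rw [pderivCoord_add (differentiableAt (hL a) hq) (differentiableAt (hM a) hq),
    pderivCoord_add (differentiableAt (hL b) hq) (differentiableAt (hM b) hq)]
  ring

lemma symCovDeriv_smul (c : ℝ) (L : (Fin n → ℝ) → Fin n → ℝ) (q : Fin n → ℝ) (a b : Fin n) :
    S.symCovDeriv (fun q a => c * L q a) q a b = c * S.symCovDeriv L q a b := by
  simp only [symCovDeriv, covDeriv₁, pderivCoord_smul, mul_left_comm _ c, ← Finset.mul_sum]
  ring

lemma symCovDeriv_symm (L : (Fin n → ℝ) → Fin n → ℝ) (q : Fin n → ℝ) (a b : Fin n) :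
    S.symCovDeriv L q a b = S.symCovDeriv L q b a := by
  simp only [symCovDeriv]
  ring

lemma symCovDeriv_zero (q : Fin n → ℝ) (a b : Fin n) :
    S.symCovDeriv (fun _ _ => 0) q a b = 0 := by
  simpa using S.symCovDeriv_smul 0 (fun _ _ => 0) q a b

lemma IsCovectorField.add {L M : (Fin n → ℝ) → Fin n → ℝ} (hL : S.IsCovectorField L)
    (hM : S.IsCovectorField M) : S.IsCovectorField (fun q a => L q a + M q a) :=
  fun a => (hL a).add (hM a)

lemma IsCovectorField.smul {L : (Fin n → ℝ) → Fin n → ℝ} (hL : S.IsCovectorField L) (c : ℝ) :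
    S.IsCovectorField (fun q a => c * L q a) :=
  fun a => contDiffOn_const.mul (hL a)

lemma IsCovectorField.zero : S.IsCovectorField (fun _ _ => 0) := fun _ => contDiffOn_const

/-- Since `S.U` is open, fields that agree on it have the same derivatives there, whatever their
values outside. -/
lemma IsKillingTensor.congr {C D : (Fin n → ℝ) → Fin n → Fin n → ℝ} (hC : S.IsKillingTensor C)
    (h : ∀ q ∈ S.U, ∀ a b, D q a b = C q a b) : S.IsKillingTensor D := by
  refine ⟨fun a b => (hC.1 a b).congr fun q hq => h q hq a b, fun q hq a b => ?_,
    fun q hq a b c => ?_⟩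
  · rw [h q hq, h q hq, hC.2.1 q hq]
  · rw [← hC.2.2 q hq a b c]
    have key : ∀ a b c, S.covDeriv₂ D q a b c = S.covDeriv₂ C q a b c := by
      intro a b c
      simp only [covDeriv₂]
      rw [pderivCoord_congr S.isOpen_U (fun x hx => h x hx a b) hq]
      simp only [h q hq]
    simp only [key]

lemma IsKillingTensor.smul {C : (Fin n → ℝ) → Fin n → Fin n → ℝ} (hC : S.IsKillingTensor C)
    (k : ℝ) : S.IsKillingTensor (fun q a b => k * C q a b) := by
  refine ⟨fun a b => contDiffOn_const.mul (hC.1 a b), fun q hq a b => ?_,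
    fun q hq a b c => ?_⟩
  · simp only [hC.2.1 q hq a b]
  · have key : ∀ a b c, S.covDeriv₂ (fun q a b => k * C q a b) q a b c
        = k * S.covDeriv₂ C q a b c := by
      intro a b c
      simp only [covDeriv₂, pderivCoord_smul, mul_left_comm _ k, ← Finset.mul_sum]
      ring
    rw [key, key, key, ← mul_add, ← mul_add, hC.2.2 q hq, mul_zero]

lemma IsKillingTensor.add {C D : (Fin n → ℝ) → Fin n → Fin n → ℝ} (hC : S.IsKillingTensor C)
    (hD : S.IsKillingTensor D) : S.IsKillingTensor (fun q a b => C q a b + D q a b) := by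
  refine ⟨fun a b => (hC.1 a b).add (hD.1 a b), fun q hq a b => ?_, fun q hq a b c => ?_⟩
  · simp only [hC.2.1 q hq a b, hD.2.1 q hq a b]
  · have key : ∀ a b c, S.covDeriv₂ (fun q a b => C q a b + D q a b) q a b c
        = S.covDeriv₂ C q a b c + S.covDeriv₂ D q a b c := by
      intro a b c
      simp only [covDeriv₂, mul_add, Finset.sum_add_distrib]
      rw [pderivCoord_add (differentiableAt (hC.1 a b) hq) (differentiableAt (hD.1 a b) hq)]
      ring
    rw [key, key, key]
    linear_combination hC.2.2 q hq a b c + hD.2.2 q hq a b c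

lemma IsKillingTensor.zero : S.IsKillingTensor (fun _ _ _ => 0) := by
  refine ⟨fun _ _ => contDiffOn_const, fun _ _ _ _ => rfl, fun q _ a b c => ?_⟩
  simp [covDeriv₂, pderivCoord]

end Linearity

/-! ### Derivatives along solutions -/

section AlongSolutions

variable {S} {q v : ℝ → Fin n → ℝ} {t : ℝ}

/-- The acceleration contributes exactly the connection term of `covDeriv₁`, and contraction with
the velocity twice sees only the symmetric part. -/
lemma hasDerivAt_linForm {L : (Fin n → ℝ) → Fin n → ℝ}
    (hL : ∀ a, DifferentiableAt ℝ (fun x => L x a) (q t)) (hq : HasDerivAt q (v t) t)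
    (hv : HasDerivAt v (S.accel (q t) (v t)) t) :
    HasDerivAt (fun s => linForm (L (q s)) (v s))
      (quadForm (S.symCovDeriv L (q t)) (v t) - S.alongV L (q t)) t := by
  have h : HasDerivAt (fun s => linForm (L (q s)) (v s)) _ t :=
    HasDerivAt.fun_sum fun a _ =>
      (hasDerivAt_comp_path (hL a) hq).fun_mul (hasDerivAt_pi.1 hv a)
  convert h using 1
  generalize q t = x
  generalize v t = w
  have h1 : quadForm (S.symCovDeriv L x) w = ∑ a, ∑ b, S.covDeriv₁ L x a b * w a * w b := by
    have h2 : ∑ a, ∑ b, S.covDeriv₁ L x b a * w a * w b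
        = ∑ a, ∑ b, S.covDeriv₁ L x a b * w a * w b := by
      rw [Finset.sum_comm]
      exact Finset.sum_congr rfl fun a _ => Finset.sum_congr rfl fun b _ => by ring
    have h3 : quadForm (S.symCovDeriv L x) w
        = 1 / 2 * ((∑ a, ∑ b, S.covDeriv₁ L x a b * w a * w b)
          + ∑ a, ∑ b, S.covDeriv₁ L x b a * w a * w b) := by
      simp only [quadForm, symCovDeriv, ← Finset.sum_add_distrib, Finset.mul_sum]
      exact Finset.sum_congr rfl fun a _ => Finset.sum_congr rfl fun b _ => by ring
    rw [h3, h2]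
    ring
  have h4 : ∑ a, ∑ b, (∑ c, S.christoffel c a b x * L x c) * w a * w b
      = ∑ c, L x c * ∑ a, ∑ b, S.christoffel c a b x * w a * w b := by
    simp only [Finset.sum_mul, Finset.mul_sum]
    rw [sum_rotate]
    exact Finset.sum_congr rfl fun a _ => Finset.sum_congr rfl fun b _ =>
      Finset.sum_congr rfl fun c _ => by ring
  have h5 : ∑ a, linForm (fun b => pderivCoord b (fun x => L x a) x) w * w a
      = ∑ a, ∑ b, pderivCoord b (fun x => L x a) x * w a * w b := by
    simp only [linForm, Finset.sum_mul]
    exact Finset.sum_congr rfl fun a _ => Finset.sum_congr rfl fun b _ => by ring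
  rw [h1, Finset.sum_add_distrib, h5]
  simp only [accel, covDeriv₁, alongV, sub_mul, mul_sub, mul_neg, Finset.sum_sub_distrib,
    Finset.sum_neg_distrib, h4]
  ring

/-- Differentiating each of the two velocity factors supplies one of the two connection terms of
`covDeriv₂`. By symmetry of `C` both factors contribute equally, whence the factor 2 on the
potential term. -/
lemma hasDerivAt_quadForm {C : (Fin n → ℝ) → Fin n → Fin n → ℝ}
    (hC : ∀ a b, DifferentiableAt ℝ (fun x => C x a b) (q t))
    (hsymm : ∀ a b, C (q t) a b = C (q t) b a) (hq : HasDerivAt q (v t) t)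
    (hv : HasDerivAt v (S.accel (q t) (v t)) t) :
    HasDerivAt (fun s => quadForm (C (q s)) (v s))
      (∑ a, ∑ b, ∑ c, S.covDeriv₂ C (q t) a b c * v t a * v t b * v t c
        - 2 * linForm (S.contractV C (q t)) (v t)) t := by
  have h : HasDerivAt (fun s => quadForm (C (q s)) (v s)) _ t :=
    HasDerivAt.fun_sum fun a _ => HasDerivAt.fun_sum fun b _ =>
      ((hasDerivAt_comp_path (hC a b) hq).fun_mul (hasDerivAt_pi.1 hv a)).fun_mul
        (hasDerivAt_pi.1 hv b)
  convert h using 1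
  generalize q t = x at *
  generalize v t = w
  have h1 : ∑ a, ∑ b, ∑ c, (∑ d, S.christoffel d a c x * C x d b) * w a * w b * w c
      = ∑ a, ∑ b, C x a b * (∑ c, ∑ d, S.christoffel a c d x * w c * w d) * w b := by
    simp only [Finset.sum_mul, Finset.mul_sum]
    rw [Finset.sum_comm]
    conv_rhs => rw [Finset.sum_comm]
    refine Finset.sum_congr rfl fun b _ => ?_
    rw [sum_rotate]
    exact Finset.sum_congr rfl fun a _ => Finset.sum_congr rfl fun c _ =>
      Finset.sum_congr rfl fun d _ => by ring
  have h2 : ∑ a, ∑ b, ∑ c, (∑ d, S.christoffel d b c x * C x a d) * w a * w b * w c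
      = ∑ a, ∑ b, C x a b * (∑ c, ∑ d, S.christoffel a c d x * w c * w d) * w b := by
    rw [← h1, Finset.sum_comm]
    refine Finset.sum_congr rfl fun a _ => Finset.sum_congr rfl fun b _ =>
      Finset.sum_congr rfl fun c _ => ?_
    simp only [hsymm b]
    ring
  have h3 : ∑ a, ∑ b, C x a b * w a * (S.accel x w b)
      = ∑ a, ∑ b, C x a b * (S.accel x w a) * w b := by
    rw [Finset.sum_comm]
    refine Finset.sum_congr rfl fun a _ => Finset.sum_congr rfl fun b _ => ?_
    rw [hsymm b a]
    ring
  have h4 : linForm (S.contractV C x) w = ∑ a, ∑ b, C x a b * S.gradV x a * w b := by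
    simp only [linForm, contractV, Finset.sum_mul]
    rw [Finset.sum_comm]
    refine Finset.sum_congr rfl fun a _ => Finset.sum_congr rfl fun b _ => ?_
    rw [hsymm b a]
  have h5 : ∑ a, ∑ b, C x a b * (S.accel x w a) * w b
      = -(∑ a, ∑ b, C x a b * (∑ c, ∑ d, S.christoffel a c d x * w c * w d) * w b)
        - ∑ a, ∑ b, C x a b * S.gradV x a * w b := by
    simp only [accel, mul_sub, sub_mul, mul_neg, neg_mul, Finset.sum_sub_distrib,
      Finset.sum_neg_distrib]
  have h6 : ∑ a, ∑ b, linForm (fun c => pderivCoord c (fun x => C x a b) x) w * w a * w b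
      = ∑ a, ∑ b, ∑ c, pderivCoord c (fun x => C x a b) x * w a * w b * w c := by
    simp only [linForm, Finset.sum_mul]
    exact Finset.sum_congr rfl fun a _ => Finset.sum_congr rfl fun b _ =>
      Finset.sum_congr rfl fun c _ => by ring
  simp only [add_mul, Finset.sum_add_distrib, covDeriv₂, sub_mul, Finset.sum_sub_distrib,
    h1, h2, h3, h4, h5, h6]
  ring

/-- The monomial in `w` is invariant under cyclic rotation of the indices, so three times the cubic
form is the form of the cyclic sum. -/
lemma sum_cyclic (T : Fin n → Fin n → Fin n → ℝ) (w : Fin n → ℝ)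
    (hT : ∀ a b c, T a b c + T b c a + T c a b = 0) :
    ∑ a, ∑ b, ∑ c, T a b c * w a * w b * w c = 0 := by
  have h1 : ∑ a, ∑ b, ∑ c, T b c a * w a * w b * w c
      = ∑ a, ∑ b, ∑ c, T a b c * w a * w b * w c := by
    rw [sum_rotate fun a b c => T a b c * w a * w b * w c]
    exact Finset.sum_congr rfl fun a _ => Finset.sum_congr rfl fun b _ =>
      Finset.sum_congr rfl fun c _ => by ring
  have h2 : ∑ a, ∑ b, ∑ c, T c a b * w a * w b * w c
      = ∑ a, ∑ b, ∑ c, T a b c * w a * w b * w c := by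
    rw [sum_rotate]
    exact Finset.sum_congr rfl fun a _ => Finset.sum_congr rfl fun b _ =>
      Finset.sum_congr rfl fun c _ => by ring
  have h3 : (∑ a, ∑ b, ∑ c, T a b c * w a * w b * w c)
      + (∑ a, ∑ b, ∑ c, T b c a * w a * w b * w c)
      + (∑ a, ∑ b, ∑ c, T c a b * w a * w b * w c) = 0 := by
    simp only [← Finset.sum_add_distrib, ← add_mul, hT, zero_mul, Finset.sum_const_zero]
  linarith

lemma IsKillingTensor.hasDerivAt_quadForm {C : (Fin n → ℝ) → Fin n → Fin n → ℝ}
    (hC : S.IsKillingTensor C) (ht : q t ∈ S.U) (hq : HasDerivAt q (v t) t)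
    (hv : HasDerivAt v (S.accel (q t) (v t)) t) :
    HasDerivAt (fun s => quadForm (C (q s)) (v s)) (-2 * linForm (S.contractV C (q t)) (v t))
      t := by
  convert ConservativeSystem.hasDerivAt_quadForm (fun a b => differentiableAt (hC.1 a b) ht)
    (hC.2.1 _ ht) hq hv using 1
  rw [sum_cyclic _ _ (hC.2.2 _ ht)]
  ring

lemma hasDerivAt_alongV {L : (Fin n → ℝ) → Fin n → ℝ} (hL : S.IsCovectorField L)
    (ht : q t ∈ S.U) (hq : HasDerivAt q (v t) t) :
    HasDerivAt (fun s => S.alongV L (q s))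
      (linForm (fun a => pderivCoord a (S.alongV L) (q t)) (v t)) t :=
  hasDerivAt_comp_path (differentiableAt (alongV_smooth hL) ht) hq

lemma IsCovectorField.hasDerivAt_linForm {L : (Fin n → ℝ) → Fin n → ℝ}
    (hL : S.IsCovectorField L) (ht : q t ∈ S.U) (hq : HasDerivAt q (v t) t)
    (hv : HasDerivAt v (S.accel (q t) (v t)) t) :
    HasDerivAt (fun s => linForm (L (q s)) (v s))
      (quadForm (S.symCovDeriv L (q t)) (v t) - S.alongV L (q t)) t :=
  ConservativeSystem.hasDerivAt_linForm (fun a => differentiableAt (hL a) ht) hq hv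

end AlongSolutions

/-! ### The three types are first integrals -/

section FirstIntegrals

variable {S} {T : Set ℝ}

lemma IsData₁.isFirstIntegral {C : (Fin n → ℝ) → Fin n → Fin n → ℝ}
    {L : (Fin n → ℝ) → Fin n → ℝ} {G : (Fin n → ℝ) → ℝ} (h : S.IsData₁ C L G) :
    S.IsFirstIntegral T (S.I₁ C L G) := by
  intro J _ _ q v hsol t ht
  obtain ⟨hU, hq, hv⟩ := hsol t ht
  have d0 := hasDerivAt_id' t
  have d1 := h.L_killing.hasDerivAt_quadForm hU hq hv
  have d2 := h.C_killing.hasDerivAt_quadForm hU hq hv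
  have d3 := h.L_smooth.hasDerivAt_linForm hU hq hv
  have d4 := hasDerivAt_alongV h.L_smooth hU hq
  have d5 := hasDerivAt_comp_path (differentiableAt h.G_smooth hU) hq
  have e4 : linForm (fun a => pderivCoord a (S.alongV L) (q t)) (v t)
      = -2 * linForm (S.contractV (S.symCovDeriv L) (q t)) (v t) := by
    rw [← linForm_smul]
    exact congrArg (linForm · _) (funext fun a => h.L_constraint _ hU a)
  have e5 : linForm (fun a => pderivCoord a G (q t)) (v t)
      = 2 * linForm (S.contractV C (q t)) (v t) + -1 * linForm (L (q t)) (v t) := by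
    rw [← linForm_smul, ← linForm_smul, ← linForm_add]
    exact congrArg (linForm · _) (funext fun a => by rw [h.G_constraint _ hU a]; ring)
  rw [e4] at d4
  rw [e5] at d5
  have key := ((((((d0.fun_pow 2).div_const 2).fun_neg.fun_mul d1).fun_add d2).fun_add
    (d0.fun_mul d3)).fun_add (((d0.fun_pow 2).div_const 2).fun_mul d4)).fun_add d5
  refine key.congr_deriv ?_
  norm_num
  ring

lemma IsData₂.isFirstIntegral {L B : (Fin n → ℝ) → Fin n → ℝ} (h : S.IsData₂ L B) :
    S.IsFirstIntegral T (S.I₂ L B) := by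
  intro J _ _ q v hsol t ht
  obtain ⟨hU, hq, hv⟩ := hsol t ht
  have d0 := hasDerivAt_id' t
  have d1 := h.L_killing.hasDerivAt_quadForm hU hq hv
  have d2 := h.B_killing.hasDerivAt_quadForm hU hq hv
  have d3 := h.L_smooth.hasDerivAt_linForm hU hq hv
  have d4 := h.B_smooth.hasDerivAt_linForm hU hq hv
  have d5 := hasDerivAt_alongV h.L_smooth hU hq
  have d6 := hasDerivAt_alongV h.B_smooth hU hq
  have e5 : linForm (fun a => pderivCoord a (S.alongV L) (q t)) (v t)
      = -2 * linForm (S.contractV (S.symCovDeriv L) (q t)) (v t) := by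
    rw [← linForm_smul]
    exact congrArg (linForm · _) (funext fun a => h.L_constraint _ hU a)
  have e6 : linForm (fun a => pderivCoord a (S.alongV B) (q t)) (v t)
      = -2 * linForm (S.contractV (S.symCovDeriv B) (q t)) (v t)
        + -2 * linForm (L (q t)) (v t) := by
    rw [← linForm_smul, ← linForm_smul, ← linForm_add]
    exact congrArg (linForm · _) (funext fun a => by rw [h.B_constraint _ hU a]; ring)
  rw [e5] at d5
  rw [e6] at d6
  have key := (((((((d0.fun_pow 3).div_const 3).fun_neg.fun_mul d1).fun_add
    ((d0.fun_pow 2).fun_mul d3)).fun_add (((d0.fun_pow 3).div_const 3).fun_mul d5)).fun_sub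
    (d0.fun_mul d2)).fun_add d4).fun_add (d0.fun_mul d6)
  refine key.congr_deriv ?_
  norm_num
  ring

lemma hasDerivAt_exp_mul (l : ℂ) (t : ℝ) :
    HasDerivAt (fun s : ℝ => Complex.exp (l * s)) (Complex.exp (l * t) * l) t := by
  have := (((hasDerivAt_id' t).ofReal_comp).const_mul l).cexp
  simpa using this

lemma IsData₃.isFirstIntegral {l : ℂ} {L : (Fin n → ℝ) → Fin n → ℝ} (h : S.IsData₃ l L) :
    S.IsFirstIntegral T (S.I₃ l L) := by
  intro J _ _ q v hsol t ht
  obtain ⟨hU, hq, hv⟩ := hsol t ht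
  have d0 := hasDerivAt_exp_mul l t
  have d1 := (h.L_killing.hasDerivAt_quadForm hU hq hv).ofReal_comp
  have d2 := (h.L_smooth.hasDerivAt_linForm hU hq hv).ofReal_comp
  have d3 := (hasDerivAt_alongV h.L_smooth hU hq).ofReal_comp
  have e3 : ((linForm (fun a => pderivCoord a (S.alongV L) (q t)) (v t) : ℝ) : ℂ)
      = -2 * ((linForm (S.contractV (S.symCovDeriv L) (q t)) (v t) : ℝ) : ℂ)
        - l ^ 2 * ((linForm (L (q t)) (v t) : ℝ) : ℂ) := by
    simp only [linForm, Complex.ofReal_sum, Complex.ofReal_mul, h.L_constraint _ hU,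
      Finset.mul_sum, ← Finset.sum_sub_distrib]
    exact Finset.sum_congr rfl fun a _ => by ring
  rw [e3] at d3
  have key := ((d0.fun_neg.fun_mul d1).fun_add ((d0.const_mul l).fun_mul d2)).fun_add
    (d0.fun_mul d3)
  refine key.congr_deriv ?_
  push_cast
  ring

end FirstIntegrals

end ConservativeSystem

/-! ### Calculus on an interval of time -/

section Calculus

variable {n : ℕ}

lemma eq_of_hasDerivAt_zero {F : Type*} [NormedAddCommGroup F] [NormedSpace ℝ F] {T : Set ℝ}
    (hT : IsOpen T) (hconn : T.OrdConnected) {φ : ℝ → F} (h : ∀ t ∈ T, HasDerivAt φ 0 t)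
    {s t : ℝ} (hs : s ∈ T) (ht : t ∈ T) : φ s = φ t :=
  hT.is_const_of_deriv_eq_zero hconn.isPreconnected
    (fun x hx => (h x hx).differentiableAt.differentiableWithinAt) (fun x hx => (h x hx).deriv)
    hs ht

lemma exists_primitive {T : Set ℝ} (hT : IsOpen T) (hconn : T.OrdConnected) (hne : T.Nonempty)
    {f : ℝ → ℝ} (hf : ContinuousOn f T) : ∃ h : ℝ → ℝ, ∀ t ∈ T, HasDerivAt h (f t) t := by
  obtain ⟨t₀, ht₀⟩ := hne
  refine ⟨fun t => ∫ s in t₀..t, f s, fun t ht => ?_⟩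
  refine intervalIntegral.integral_hasDerivAt_right ?_ ?_ (hf.continuousAt (hT.mem_nhds ht))
  · exact (hf.mono (hconn.uIcc_subset ht₀ ht)).intervalIntegrable
  · exact hf.stronglyMeasurableAtFilter hT t ht

/-- Allows an identity valid on an open set of times to be differentiated at a point of it. -/
lemma HasDerivAt.eq_zero_of_forall_eq {F : Type*} [NormedAddCommGroup F] [NormedSpace ℝ F]
    {T : Set ℝ} (hT : IsOpen T) {φ : ℝ → F} {c φ' : F} (h : ∀ t ∈ T, φ t = c) {t : ℝ}
    (ht : t ∈ T) (hφ : HasDerivAt φ φ' t) : φ' = 0 :=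
  hφ.unique ((hasDerivAt_const t c).congr_of_eventuallyEq
    (Filter.eventuallyEq_of_mem (hT.mem_nhds ht) h))

lemma hasDerivAt_comp_time_path {K : ℝ → (Fin n → ℝ) → ℝ} {q v : ℝ → Fin n → ℝ} {t : ℝ}
    (hK : DifferentiableAt ℝ (fun p : ℝ × (Fin n → ℝ) => K p.1 p.2) (t, q t))
    (hq : HasDerivAt q (v t) t) :
    HasDerivAt (fun s => K s (q s))
      (deriv (fun s => K s (q t)) t + linForm (fun a => pderivCoord a (K t) (q t)) (v t)) t := by
  have h := hK.hasFDerivAt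
  have h1 := h.comp_hasDerivAt (f := fun s => (s, q t)) t
    ((hasDerivAt_id' t).prodMk (hasDerivAt_const t (q t)))
  have h2 := h.comp (f := fun x => (t, x)) (q t)
    ((hasFDerivAt_const t (q t)).prodMk (hasFDerivAt_id (q t)))
  have h3 := h.comp_hasDerivAt (f := fun s => (s, q s)) t ((hasDerivAt_id' t).prodMk hq)
  have e1 : deriv (fun s => K s (q t)) t = _ := h1.deriv
  have e2 : fderiv ℝ (K t) (q t) = _ := h2.fderiv
  refine h3.congr_deriv ?_
  rw [← fderiv_eq_linForm, e1, e2]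
  simp [← map_add]

end Calculus

/-! ### Local solutions and the determining equations -/

namespace ConservativeSystem

variable {n : ℕ} {S : ConservativeSystem n}

lemma contDiffOn_accel :
    ContDiffOn ℝ ∞ (fun p : (Fin n → ℝ) × (Fin n → ℝ) => S.accel p.1 p.2)
      (S.U ×ˢ Set.univ) := by
  have hfst : ∀ {F : (Fin n → ℝ) → ℝ}, ContDiffOn ℝ ∞ F S.U →
      ContDiffOn ℝ ∞ (fun p : (Fin n → ℝ) × (Fin n → ℝ) => F p.1) (S.U ×ˢ Set.univ) :=
    fun hF => hF.comp contDiffOn_fst fun p hp => hp.1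
  have hsnd : ∀ a, ContDiffOn ℝ ∞ (fun p : (Fin n → ℝ) × (Fin n → ℝ) => p.2 a)
      (S.U ×ˢ Set.univ) :=
    fun a => ((contDiff_apply ℝ ℝ a).comp contDiff_snd).contDiffOn
  refine contDiffOn_pi.2 fun a => ?_
  refine (ContDiffOn.neg ?_).sub (hfst (S.gradV_smooth a))
  exact ContDiffOn.sum fun b _ => ContDiffOn.sum fun c _ =>
    ((hfst (S.christoffel_smooth a b c)).mul (hsnd b)).mul (hsnd c)

/-- Picard–Lindelöf for the first-order system q' = v, v' = `accel`, restricted to times at which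
the curve is still in `S.U`. -/
lemma exists_isSolution {T : Set ℝ} (hT : IsOpen T) {t₀ : ℝ} (ht₀ : t₀ ∈ T) {q₀ : Fin n → ℝ}
    (hq₀ : q₀ ∈ S.U) (v₀ : Fin n → ℝ) :
    ∃ J : Set ℝ, IsOpen J ∧ J ⊆ T ∧ t₀ ∈ J ∧ ∃ q v : ℝ → Fin n → ℝ,
      S.IsSolution J q v ∧ q t₀ = q₀ ∧ v t₀ = v₀ := by
  have hopen : IsOpen (S.U ×ˢ (Set.univ : Set (Fin n → ℝ))) := S.isOpen_U.prod isOpen_univ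
  have hX : ContDiffAt ℝ 1 (fun p : (Fin n → ℝ) × (Fin n → ℝ) => (p.2, S.accel p.1 p.2))
      (q₀, v₀) :=
    (contDiffAt_snd.prodMk ((contDiffOn_accel (S := S)).contDiffAt
      (hopen.mem_nhds ⟨hq₀, trivial⟩))).of_le (by exact_mod_cast le_top)
  obtain ⟨γ, hγ₀, ε, hε, hγ⟩ :=
    hX.exists_forall_mem_closedBall_exists_eq_forall_mem_Ioo_hasDerivAt₀ t₀
  have hmem : t₀ ∈ Set.Ioo (t₀ - ε) (t₀ + ε) := by constructor <;> linarith
  have hcont : ContinuousOn (fun t => (γ t).1) (Set.Ioo (t₀ - ε) (t₀ + ε)) := fun t ht =>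
    (hγ t ht).continuousAt.fst.continuousWithinAt
  refine ⟨T ∩ (Set.Ioo (t₀ - ε) (t₀ + ε) ∩ (fun t => (γ t).1) ⁻¹' S.U),
    hT.inter (hcont.isOpen_inter_preimage isOpen_Ioo S.isOpen_U), Set.inter_subset_left,
    ⟨ht₀, hmem, by simpa [hγ₀] using hq₀⟩, fun t => (γ t).1, fun t => (γ t).2, ?_, by simp [hγ₀],
    by simp [hγ₀]⟩
  rintro t ⟨-, ht, htU⟩
  have := hγ t ht
  exact ⟨htU, this.fst, this.snd⟩

section Ansatz

variable {T : Set ℝ} {g f : ℝ → ℝ} {C : (Fin n → ℝ) → Fin n → Fin n → ℝ}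
  {L B : (Fin n → ℝ) → Fin n → ℝ} {K : ℝ → (Fin n → ℝ) → ℝ}

/-- The determining equations obtained by splitting `dI/dt = 0` into homogeneous parts in the
velocity. -/
structure DeterminingEquations (S : ConservativeSystem n) (T : Set ℝ) (g f : ℝ → ℝ)
    (C : (Fin n → ℝ) → Fin n → Fin n → ℝ) (L B : (Fin n → ℝ) → Fin n → ℝ)
    (K : ℝ → (Fin n → ℝ) → ℝ) : Prop where
  quadratic : ∀ t ∈ T, ∀ q ∈ S.U, ∀ a b,
    deriv g t * C q a b + f t * S.symCovDeriv L q a b + S.symCovDeriv B q a b = 0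
  linear : ∀ t ∈ T, ∀ q ∈ S.U, ∀ a,
    pderivCoord a (K t) q = 2 * g t * S.contractV C q a - deriv f t * L q a
  constant : ∀ t ∈ T, ∀ q ∈ S.U,
    HasDerivAt (fun s => K s q) (f t * S.alongV L q + S.alongV B q) t

lemma IsFirstIntegral.determiningEquations (hT : IsOpen T) (hg : AnalyticOnNhd ℝ g T)
    (hf : AnalyticOnNhd ℝ f T) (hC : S.IsKillingTensor C) (hL : S.IsCovectorField L)
    (hB : S.IsCovectorField B)
    (hK : ContDiffOn ℝ ∞ (fun p : ℝ × (Fin n → ℝ) => K p.1 p.2) (T ×ˢ S.U))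
    (hI : S.IsFirstIntegral T (ansatz g f C L B K)) :
    S.DeterminingEquations T g f C L B K := by
  have hKd : ∀ t ∈ T, ∀ q ∈ S.U,
      DifferentiableAt ℝ (fun p : ℝ × (Fin n → ℝ) => K p.1 p.2) (t, q) := fun t ht q hq =>
    (hK.differentiableOn (by simp) (t, q) ⟨ht, hq⟩).differentiableAt
      ((hT.prod S.isOpen_U).mem_nhds ⟨ht, hq⟩)
  have main : ∀ t ∈ T, ∀ q ∈ S.U, ∀ v,
      quadForm (fun a b => deriv g t * C q a b + f t * S.symCovDeriv L q a b
          + S.symCovDeriv B q a b) v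
        + linForm (fun a => -2 * g t * S.contractV C q a + deriv f t * L q a
          + pderivCoord a (K t) q) v
        + (deriv (fun s => K s q) t - (f t * S.alongV L q + S.alongV B q)) = 0 := by
    intro t ht q₀ hq₀ v₀
    -- The initial data are arbitrary, so an identity along solutions becomes one in (t, q, v).
    obtain ⟨J, hJ, hJT, htJ, q, v, hsol, rfl, rfl⟩ := exists_isSolution hT ht hq₀ v₀
    have h0 := hI J hJ hJT q v hsol t htJ
    obtain ⟨hU, hq, hv⟩ := hsol t htJ
    have d1 := (hg t ht).differentiableAt.hasDerivAt.fun_mul (hC.hasDerivAt_quadForm hU hq hv)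
    have d2 := (hf t ht).differentiableAt.hasDerivAt.fun_mul (hL.hasDerivAt_linForm hU hq hv)
    have d3 := hB.hasDerivAt_linForm hU hq hv
    have d4 := hasDerivAt_comp_time_path (hKd t ht _ hU) hq
    have key := h0.unique ((d1.fun_add (d2.fun_add d3)).fun_add d4)
    rw [quadForm_add, quadForm_add, linForm_add, linForm_add, quadForm_smul, quadForm_smul,
      linForm_smul, linForm_smul]
    linear_combination -key
  have split := fun t ht q hq => forms_eq_zero (main t ht q hq)
  refine ⟨fun t ht q hq => ?_, fun t ht q hq a => ?_, fun t ht q hq => ?_⟩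
  · exact eq_zero_of_quadForm_eq_zero (fun a b => by
      rw [hC.2.1 q hq a b, S.symCovDeriv_symm L q a b, S.symCovDeriv_symm B q a b])
      (split t ht q hq).1
  · have := (split t ht q hq).2.1 (Pi.single a 1)
    rw [linForm_single] at this
    linarith
  · have h1 : DifferentiableAt ℝ (fun s => K s q) t :=
      (hKd t ht q hq).comp (f := fun s => (s, q)) t
        (differentiableAt_id.prodMk (differentiableAt_const q))
    rw [← sub_eq_zero.1 (split t ht q hq).2.2]
    exact h1.hasDerivAt

/-- Used to eliminate g' from the integrability condition. -/
lemma DeterminingEquations.contractV_eq (h : S.DeterminingEquations T g f C L B K) {t : ℝ}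
    (ht : t ∈ T) {q : Fin n → ℝ} (hq : q ∈ S.U) (a : Fin n) :
    deriv g t * S.contractV C q a + f t * S.contractV (S.symCovDeriv L) q a
      + S.contractV (S.symCovDeriv B) q a = 0 := by
  rw [← contractV_smul, ← contractV_smul, ← contractV_add, ← contractV_add]
  exact Finset.sum_eq_zero fun b _ => by
    simp only [h.quadratic t ht q hq, zero_mul]

/-- The integrability condition of the determining equations for `K`. -/
lemma DeterminingEquations.integrability (h : S.DeterminingEquations T g f C L B K)
    (hT : IsOpen T) (hconn : T.OrdConnected) (hg : AnalyticOnNhd ℝ g T)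
    (hf : AnalyticOnNhd ℝ f T) (hL : S.IsCovectorField L) (hB : S.IsCovectorField B)
    (hK : ContDiffOn ℝ ∞ (fun p : ℝ × (Fin n → ℝ) => K p.1 p.2) (T ×ˢ S.U))
    {t : ℝ} (ht : t ∈ T) {q : Fin n → ℝ} (hq : q ∈ S.U) (a : Fin n) :
    L q a * deriv (deriv f) t
      + (pderivCoord a (S.alongV L) q + 2 * S.contractV (S.symCovDeriv L) q a) * f t
      + (pderivCoord a (S.alongV B) q + 2 * S.contractV (S.symCovDeriv B) q a) = 0 := by
  obtain ⟨p, hp⟩ := exists_primitive hT hconn ⟨t, ht⟩ hf.continuousOn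
  have hLV := differentiableAt (alongV_smooth hL) hq
  have hBV := differentiableAt (alongV_smooth hB) hq
  have hKt : DifferentiableAt ℝ (K t) q := by
    refine differentiableAt (S := S) (F := K t) ?_ hq
    exact hK.comp (contDiffOn_const.prodMk contDiffOn_id) fun x hx => ⟨ht, hx⟩
  -- Integrating K_t in time makes the dependence of K on time explicit, so that no interchange of
  -- mixed partial derivatives is needed.
  have hKs : ∀ s ∈ T, ∀ x ∈ S.U,
      K s x = K t x + ((p s - p t) * S.alongV L x + (s - t) * S.alongV B x) := by
    intro s hs x hx
    have := eq_of_hasDerivAt_zero hT hconn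
      (φ := fun s => K s x - (p s * S.alongV L x + s * S.alongV B x)) (fun r hr =>
        ((h.constant r hr x hx).fun_sub (((hp r hr).mul_const _).fun_add
          ((hasDerivAt_id' r).mul_const _))).congr_deriv (by ring)) hs ht
    linear_combination this
  have hpd : ∀ s ∈ T, pderivCoord a (K s) q = pderivCoord a (K t) q
      + ((p s - p t) * pderivCoord a (S.alongV L) q + (s - t) * pderivCoord a (S.alongV B) q) := by
    intro s hs
    rw [pderivCoord_congr S.isOpen_U (hKs s hs) hq,
      pderivCoord_add hKt ((hLV.const_mul _).fun_add (hBV.const_mul _)),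
      pderivCoord_add (hLV.const_mul _) (hBV.const_mul _), pderivCoord_smul, pderivCoord_smul]
  -- The right-hand side does not involve `s`; the time derivative of the left-hand side therefore
  -- vanishes.
  have hconst : ∀ s ∈ T, 2 * g s * S.contractV C q a - deriv f s * L q a
      - (p s * pderivCoord a (S.alongV L) q + s * pderivCoord a (S.alongV B) q)
      = pderivCoord a (K t) q
        - (p t * pderivCoord a (S.alongV L) q + t * pderivCoord a (S.alongV B) q) := by
    intro s hs
    linear_combination hpd s hs - h.linear s hs q hq a
  have hder := HasDerivAt.eq_zero_of_forall_eq hT hconst ht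
    (((((hg t ht).differentiableAt.hasDerivAt.const_mul 2).mul_const _).fun_sub
      ((hf.deriv t ht).differentiableAt.hasDerivAt.mul_const _)).fun_sub
      (((hp t ht).mul_const _).fun_add ((hasDerivAt_id' t).mul_const _)))
  linear_combination -hder + 2 * h.contractV_eq ht hq a

/-- The time dependence of `g C` and of `K`, once a primitive of `f` is given. -/
lemma DeterminingEquations.exists_static_parts (h : S.DeterminingEquations T g f C L B K)
    (hT : IsOpen T) (hconn : T.OrdConnected) (hne : T.Nonempty) (hg : AnalyticOnNhd ℝ g T)
    (hC : S.IsKillingTensor C) (hL : S.IsCovectorField L) (hB : S.IsCovectorField B)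
    (hSL : S.IsKillingTensor (S.symCovDeriv L)) (hSB : S.IsKillingTensor (S.symCovDeriv B))
    (hK : ContDiffOn ℝ ∞ (fun p : ℝ × (Fin n → ℝ) => K p.1 p.2) (T ×ˢ S.U))
    {a b : ℝ}
    (hLa : ∀ q ∈ S.U, ∀ i, pderivCoord i (S.alongV L) q
      = -2 * S.contractV (S.symCovDeriv L) q i - a * L q i)
    (hBb : ∀ q ∈ S.U, ∀ i, pderivCoord i (S.alongV B) q
      = -2 * S.contractV (S.symCovDeriv B) q i - b * L q i)
    {p : ℝ → ℝ} (hp : ∀ t ∈ T, HasDerivAt p (f t) t) :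
    ∃ (C₁ : (Fin n → ℝ) → Fin n → Fin n → ℝ) (G : (Fin n → ℝ) → ℝ),
      S.IsKillingTensor C₁ ∧ ContDiffOn ℝ ∞ G S.U ∧
      (∀ t ∈ T, ∀ q ∈ S.U, ∀ i, pderivCoord i G q
        = 2 * S.contractV C₁ q i + (a * p t + b * t - deriv f t) * L q i) ∧
      ∀ t ∈ T, ∀ q ∈ S.U, ∀ v, ansatz g f C L B K t q v
        = quadForm (C₁ q) v - p t * quadForm (S.symCovDeriv L q) v
          - t * quadForm (S.symCovDeriv B q) v + f t * linForm (L q) v + linForm (B q) v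
          + p t * S.alongV L q + t * S.alongV B q + G q := by
  obtain ⟨t₀, ht₀⟩ := hne
  -- Both fields are frozen at `t₀`; `hC₁t` and `hGt` show that any other time gives the same
  -- fields, since the quadratic and constant determining equations are their time derivatives.
  set C₁ : (Fin n → ℝ) → Fin n → Fin n → ℝ := fun q i j =>
    g t₀ * C q i j + p t₀ * S.symCovDeriv L q i j + t₀ * S.symCovDeriv B q i j with hC₁
  set G : (Fin n → ℝ) → ℝ := fun q => K t₀ q + ((-p t₀) * S.alongV L q + (-t₀) * S.alongV B q)
    with hG
  have hKt₀ : ContDiffOn ℝ ∞ (K t₀) S.U :=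
    hK.comp (contDiffOn_const.prodMk contDiffOn_id) fun x hx => ⟨ht₀, hx⟩
  have hC₁t : ∀ t ∈ T, ∀ q ∈ S.U, ∀ i j, C₁ q i j
      = g t * C q i j + p t * S.symCovDeriv L q i j + t * S.symCovDeriv B q i j := by
    intro t ht q hq i j
    exact eq_of_hasDerivAt_zero hT hconn
      (φ := fun t => g t * C q i j + p t * S.symCovDeriv L q i j + t * S.symCovDeriv B q i j)
      (fun r hr => ((((hg r hr).differentiableAt.hasDerivAt.mul_const _).fun_add
        ((hp r hr).mul_const _)).fun_add ((hasDerivAt_id' r).mul_const _)).congr_deriv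
        (by linear_combination h.quadratic r hr q hq i j)) ht₀ ht
  have hGt : ∀ t ∈ T, ∀ q ∈ S.U, K t q = G q + (p t * S.alongV L q + t * S.alongV B q) := by
    intro t ht x hx
    have := eq_of_hasDerivAt_zero hT hconn
      (φ := fun s => K s x - (p s * S.alongV L x + s * S.alongV B x)) (fun r hr =>
        ((h.constant r hr x hx).fun_sub (((hp r hr).mul_const _).fun_add
          ((hasDerivAt_id' r).mul_const _))).congr_deriv (by ring)) ht ht₀
    simp only [hG]
    linear_combination this
  have hGs : ContDiffOn ℝ ∞ G S.U := hKt₀.add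
    ((contDiffOn_const.mul (alongV_smooth hL)).add (contDiffOn_const.mul (alongV_smooth hB)))
  refine ⟨C₁, G, ((hC.smul _).add (hSL.smul _)).add (hSB.smul _), hGs,
    fun t ht q hq i => ?_, fun t ht q hq v => ?_⟩
  · have hLV := differentiableAt (alongV_smooth hL) hq
    have hBV := differentiableAt (alongV_smooth hB) hq
    have e1 := pderivCoord_congr S.isOpen_U (hGt t ht) hq i
    rw [pderivCoord_add (differentiableAt hGs hq) ((hLV.const_mul _).fun_add (hBV.const_mul _)),
      pderivCoord_add (hLV.const_mul _) (hBV.const_mul _), pderivCoord_smul, pderivCoord_smul,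
      hLa q hq, hBb q hq, h.linear t ht q hq] at e1
    have e2 : S.contractV C₁ q i = g t * S.contractV C q i
        + p t * S.contractV (S.symCovDeriv L) q i + t * S.contractV (S.symCovDeriv B) q i := by
      rw [contractV_congr (D := fun q i j => g t * C q i j + p t * S.symCovDeriv L q i j
        + t * S.symCovDeriv B q i j) (hC₁t t ht q hq), contractV_add, contractV_add, contractV_smul,
        contractV_smul, contractV_smul]
    rw [e2]
    linear_combination -e1
  · have e2 : quadForm (C₁ q) v = g t * quadForm (C q) v
        + p t * quadForm (S.symCovDeriv L q) v + t * quadForm (S.symCovDeriv B q) v := by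
      rw [← quadForm_smul, ← quadForm_smul, ← quadForm_smul, ← quadForm_add, ← quadForm_add]
      exact congrArg (quadForm · v) (funext fun i => funext fun j => hC₁t t ht q hq i j)
    rw [e2, ansatz, hGt t ht q hq]
    ring

end Ansatz

end ConservativeSystem

/-! ### Exponentials, polynomials and linear relations between functions of time -/

section Exponentials

/-- The two alternatives for the conjugate say that `l` is real or purely imaginary, in the form
needed to conjugate exponentials. -/
lemma exists_sq_eq {a : ℝ} (ha : a ≠ 0) :
    ∃ l : ℂ, l ≠ 0 ∧ l ^ 2 = a ∧ ((starRingEnd ℂ l = l) ∨ (starRingEnd ℂ l = -l)) := by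
  rcases lt_or_gt_of_ne ha with h | h
  · refine ⟨Complex.I * (Real.sqrt (-a) : ℝ), ?_, ?_, Or.inr (by simp)⟩
    · simpa using (Real.sqrt_pos.2 (neg_pos.2 h)).ne'
    · rw [mul_pow, Complex.I_sq, ← Complex.ofReal_pow, Real.sq_sqrt (by linarith)]
      simp
  · refine ⟨(Real.sqrt a : ℝ), ?_, ?_, Or.inl (by simp)⟩
    · simpa using (Real.sqrt_pos.2 h).ne'
    · rw [← Complex.ofReal_pow, Real.sq_sqrt h.le]

/-- Solutions of `p' = u`, `u' = a p` with `a ≠ 0` are combinations of two exponentials. -/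
lemma exists_exp_coefficients {T : Set ℝ} (hT : IsOpen T) (hconn : T.OrdConnected)
    (hne : T.Nonempty) {p u : ℝ → ℝ} {a : ℝ} (ha : a ≠ 0)
    (hp : ∀ t ∈ T, HasDerivAt p (u t) t) (hu : ∀ t ∈ T, HasDerivAt u (a * p t) t) :
    ∃ l α β : ℂ, l ≠ 0 ∧ l ^ 2 = a ∧
      ((l.im = 0 ∧ α.im = 0 ∧ β.im = 0) ∨ (l.re = 0 ∧ β = starRingEnd ℂ α)) ∧
      ∀ t ∈ T, α * Complex.exp (l * t) + β * Complex.exp (-l * t) = p t ∧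
        l * (α * Complex.exp (l * t) - β * Complex.exp (-l * t)) = u t := by
  obtain ⟨t₀, ht₀⟩ := hne
  obtain ⟨l, hl, hla, hreal⟩ := exists_sq_eq ha
  -- The system diagonalizes: p + u/m grows like exp(mt) for each root m of m² = a. The coefficients
  -- below are half of these conserved quantities for m = l and m = -l.
  have hconst : ∀ m : ℂ, m ≠ 0 → m ^ 2 = a → ∀ t ∈ T,
      Complex.exp (-m * t) * (p t + m⁻¹ * u t) = Complex.exp (-m * t₀) * (p t₀ + m⁻¹ * u t₀) := by
    intro m hm hma t ht
    refine eq_of_hasDerivAt_zero hT hconn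
      (φ := fun t : ℝ => Complex.exp (-m * t) * ((p t : ℂ) + m⁻¹ * u t)) (fun r hr => ?_) ht ht₀
    refine ((ConservativeSystem.hasDerivAt_exp_mul (-m) r).fun_mul
      ((hp r hr).ofReal_comp.fun_add ((hu r hr).ofReal_comp.const_mul m⁻¹))).congr_deriv ?_
    push_cast
    rw [← hma]
    field_simp
    ring
  have hexp : ∀ t : ℝ, Complex.exp (l * t) * Complex.exp (-l * t) = 1 := by
    intro t
    rw [← Complex.exp_add]
    simp
  refine ⟨l, Complex.exp (-l * t₀) * (p t₀ + l⁻¹ * u t₀) / 2,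
    Complex.exp (l * t₀) * (p t₀ - l⁻¹ * u t₀) / 2, hl, hla, ?_, fun t ht => ?_⟩
  · have h2 : starRingEnd ℂ 2 = 2 := map_ofNat _ 2
    rcases hreal with h | h
    · left
      simp only [← Complex.conj_eq_iff_im]
      refine ⟨h, ?_, ?_⟩ <;> simp [← Complex.exp_conj, h, h2]
    -- For imaginary `l`, conjugation exchanges the two conserved quantities.
    · right
      refine ⟨?_, ?_⟩
      · have := congrArg Complex.re h
        simp at this
        linarith
      · simp [← Complex.exp_conj, h, h2, sub_eq_add_neg, inv_neg]
  · have h1 := hconst l hl hla t ht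
    have h2 := hconst (-l) (neg_ne_zero.2 hl) (by rw [neg_sq, hla]) t ht
    rw [neg_neg, inv_neg] at h2
    have h3 := hexp t
    have hll : l * l⁻¹ = 1 := mul_inv_cancel₀ hl
    constructor
    · linear_combination (-Complex.exp (l * t) / 2) * h1 - Complex.exp (-l * t) / 2 * h2
        + p t * h3
    · linear_combination l * (-Complex.exp (l * t) / 2) * h1
        + l * Complex.exp (-l * t) / 2 * h2 + u t * h3 * (l * l⁻¹) + u t * hll

/-- Exponentials with distinct nonzero exponents are independent of cubic polynomials. -/
lemma exp_coefficients_eq_zero {T : Set ℝ} (hT : IsOpen T) (hne : T.Nonempty) {A : Finset ℂ}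
    (hA : ∀ l ∈ A, l ≠ 0) {c : ℂ → ℂ} {p₀ p₁ p₂ p₃ : ℂ}
    (h : ∀ t ∈ T, p₀ + p₁ * t + p₂ * (t : ℂ) ^ 2 + p₃ * (t : ℂ) ^ 3
      + ∑ l ∈ A, c l * Complex.exp (l * t) = 0) : ∀ l ∈ A, c l = 0 := by
  have hd : ∀ (k : ℕ) (t : ℝ), HasDerivAt (fun s : ℝ => ∑ l ∈ A, c l * l ^ k * Complex.exp (l * s))
      (∑ l ∈ A, c l * l ^ (k + 1) * Complex.exp (l * t)) t := fun k t =>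
    HasDerivAt.fun_sum fun l _ =>
      ((ConservativeSystem.hasDerivAt_exp_mul l t).const_mul _).congr_deriv (by ring)
  -- The explicit zero cubic coefficient preserves the shape of the identity, so that `step` can be
  -- iterated.
  have step : ∀ (k : ℕ) (b₀ b₁ b₂ b₃ : ℂ), (∀ t ∈ T, b₀ + b₁ * t + b₂ * (t : ℂ) ^ 2
      + b₃ * (t : ℂ) ^ 3 + ∑ l ∈ A, c l * l ^ k * Complex.exp (l * t) = 0) →
      ∀ t ∈ T, b₁ + 2 * b₂ * t + 3 * b₃ * (t : ℂ) ^ 2 + 0 * (t : ℂ) ^ 3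
        + ∑ l ∈ A, c l * l ^ (k + 1) * Complex.exp (l * t) = 0 := by
    intro k b₀ b₁ b₂ b₃ hb t ht
    have d0 := (hasDerivAt_id' t).ofReal_comp
    have := HasDerivAt.eq_zero_of_forall_eq hT hb ht
      (((((d0.const_mul b₁).const_add b₀).fun_add ((d0.fun_pow 2).const_mul b₂)).fun_add
        ((d0.fun_pow 3).const_mul b₃)).fun_add (hd k t))
    push_cast at this
    linear_combination this
  -- Four derivatives annihilate the cubic; every further one multiplies each coefficient by its
  -- exponent.
  have h4 : ∀ k : ℕ, ∀ t ∈ T, ∑ l ∈ A, c l * l ^ (k + 4) * Complex.exp (l * t) = 0 := by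
    intro k
    induction k with
    | zero =>
      have := step 3 _ _ _ _ (step 2 _ _ _ _ (step 1 _ _ _ _ (step 0 _ _ _ _ (by simpa using h))))
      simpa using this
    | succ k ih =>
      have := step (k + 4) 0 0 0 0 (by simpa using ih)
      rw [show k + 1 + 4 = k + 4 + 1 by ring]
      simpa using this
  obtain ⟨t, ht⟩ := hne
  -- At a single time all these moments vanish, so the weights are orthogonal to every polynomial in
  -- the exponent; a Lagrange basis polynomial then isolates one exponent.
  have hpoly : ∀ P : Polynomial ℂ,
      ∑ l ∈ A, c l * l ^ 4 * Complex.exp (l * t) * P.eval l = 0 := by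
    intro P
    induction P using Polynomial.induction_on' with
    | add P Q hP hQ => simp only [Polynomial.eval_add, mul_add, Finset.sum_add_distrib, hP, hQ,
        add_zero]
    | monomial k b =>
      have := congrArg (b * ·) (h4 k t ht)
      simp only [mul_zero, Finset.mul_sum] at this
      rw [← this]
      exact Finset.sum_congr rfl fun l _ => by simp only [Polynomial.eval_monomial]; ring
  intro m hm
  have := hpoly (Lagrange.basis A id m)
  rw [Finset.sum_eq_single_of_mem m hm fun l hl hlm => by
    have h0 := Lagrange.eval_basis_of_ne (v := id) hlm.symm hl
    rw [id] at h0
    rw [h0, mul_zero]] at this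
  have h1 := Lagrange.eval_basis_self (s := A) (v := id) Function.injective_id.injOn hm
  rw [id] at h1
  rw [h1, mul_one] at this
  simpa [Complex.exp_ne_zero, hA m hm] using this

/-- The value and the first three derivatives at one time form a triangular system in the
coefficients. -/
lemma cubic_coefficients_eq_zero {T : Set ℝ} (hT : IsOpen T) (hne : T.Nonempty)
    {p₀ p₁ p₂ p₃ : ℝ} (h : ∀ t ∈ T, p₀ + p₁ * t + p₂ * t ^ 2 + p₃ * t ^ 3 = 0) :
    p₀ = 0 ∧ p₁ = 0 ∧ p₂ = 0 ∧ p₃ = 0 := by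
  have step : ∀ b₀ b₁ b₂ b₃ : ℝ, (∀ t ∈ T, b₀ + b₁ * t + b₂ * t ^ 2 + b₃ * t ^ 3 = 0) →
      ∀ t ∈ T, b₁ + 2 * b₂ * t + 3 * b₃ * t ^ 2 + 0 * t ^ 3 = 0 := by
    intro b₀ b₁ b₂ b₃ hb t ht
    have d0 := hasDerivAt_id' t
    have := HasDerivAt.eq_zero_of_forall_eq hT hb ht
      ((((d0.const_mul b₁).const_add b₀).fun_add ((d0.fun_pow 2).const_mul b₂)).fun_add
        ((d0.fun_pow 3).const_mul b₃))
    norm_num at this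
    linear_combination this
  obtain ⟨t, ht⟩ := hne
  have h0 := h t ht
  have h1 := step _ _ _ _ h t ht
  have h2 := step _ _ _ _ (step _ _ _ _ h) t ht
  have h3 := step _ _ _ _ (step _ _ _ _ (step _ _ _ _ h)) t ht
  have e3 : p₃ = 0 := by linarith
  subst e3
  have e2 : p₂ = 0 := by linarith
  subst e2
  have e1 : p₁ = 0 := by linarith
  subst e1
  exact ⟨by linarith, rfl, rfl, rfl⟩

/-- As `u` is not constant on `T`, the functions u and 1 are independent, so any nontrivial relation
involves `w` and can be solved for it. It is applied with u = f and w = f'' or w = g'. -/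
lemma affine_or_independent {T : Set ℝ} {u w : ℝ → ℝ} (hu : ∃ s ∈ T, ∃ t ∈ T, u s ≠ u t) :
    (∃ a b : ℝ, ∀ t ∈ T, w t = a * u t + b) ∨
      ∀ x y z : ℝ, (∀ t ∈ T, x * w t + y * u t + z = 0) → x = 0 ∧ y = 0 ∧ z = 0 := by
  by_cases hex : ∃ x y z : ℝ, x ≠ 0 ∧ ∀ t ∈ T, x * w t + y * u t + z = 0
  · obtain ⟨x, y, z, hx, h⟩ := hex
    refine Or.inl ⟨-y / x, -z / x, fun t ht => ?_⟩
    field_simp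
    linear_combination h t ht
  · refine Or.inr fun x y z h => ?_
    have hx : x = 0 := by
      by_contra hx
      exact hex ⟨x, y, z, hx, h⟩
    subst hx
    obtain ⟨s, hs, t, ht, hst⟩ := hu
    have hy : y = 0 := by
      have : y * (u s - u t) = 0 := by linear_combination h s hs - h t ht
      exact (mul_eq_zero.1 this).resolve_right (sub_ne_zero.2 hst)
    subst hy
    exact ⟨rfl, rfl, by linarith [h s hs]⟩

end Exponentials

/-! ### Normal form and independence of the types -/

namespace ConservativeSystem

variable {n : ℕ} {S : ConservativeSystem n} {T : Set ℝ}

lemma quadForm_symCovDeriv_smul (c : ℝ) (L : (Fin n → ℝ) → Fin n → ℝ) (q v : Fin n → ℝ) :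
    quadForm (S.symCovDeriv (fun q a => c * L q a) q) v
      = c * quadForm (S.symCovDeriv L q) v := by
  rw [← quadForm_smul]
  exact congrArg (quadForm · v) (funext fun i => funext fun j => symCovDeriv_smul c L q i j)

lemma quadForm_symCovDeriv_add {L M : (Fin n → ℝ) → Fin n → ℝ} (hL : S.IsCovectorField L)
    (hM : S.IsCovectorField M) {q : Fin n → ℝ} (hq : q ∈ S.U) (v : Fin n → ℝ) :
    quadForm (S.symCovDeriv (fun q a => L q a + M q a) q) v
      = quadForm (S.symCovDeriv L q) v + quadForm (S.symCovDeriv M q) v := by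
  rw [← quadForm_add]
  exact congrArg (quadForm · v) (funext fun i => funext fun j => symCovDeriv_add hL hM hq i j)

lemma contractV_symCovDeriv_smul (c : ℝ) (L : (Fin n → ℝ) → Fin n → ℝ) (q : Fin n → ℝ)
    (a : Fin n) : S.contractV (S.symCovDeriv (fun q a => c * L q a)) q a
      = c * S.contractV (S.symCovDeriv L) q a := by
  rw [← contractV_smul]
  exact contractV_congr (symCovDeriv_smul c L q) a

lemma contractV_symCovDeriv_add {L M : (Fin n → ℝ) → Fin n → ℝ} (hL : S.IsCovectorField L)
    (hM : S.IsCovectorField M) {q : Fin n → ℝ} (hq : q ∈ S.U) (a : Fin n) :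
    S.contractV (S.symCovDeriv (fun q a => L q a + M q a)) q a
      = S.contractV (S.symCovDeriv L) q a + S.contractV (S.symCovDeriv M) q a := by
  rw [← contractV_add]
  exact contractV_congr (symCovDeriv_add hL hM hq) a

lemma pderivCoord_alongV_smul (c : ℝ) (L : (Fin n → ℝ) → Fin n → ℝ) (q : Fin n → ℝ)
    (a : Fin n) : pderivCoord a (S.alongV (fun q a => c * L q a)) q
      = c * pderivCoord a (S.alongV L) q := by
  rw [← pderivCoord_smul]
  exact congrArg (pderivCoord a · q) (funext fun x => alongV_smul c L x)

lemma pderivCoord_alongV_add {L M : (Fin n → ℝ) → Fin n → ℝ} (hL : S.IsCovectorField L)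
    (hM : S.IsCovectorField M) {q : Fin n → ℝ} (hq : q ∈ S.U) (a : Fin n) :
    pderivCoord a (S.alongV (fun q a => L q a + M q a)) q
      = pderivCoord a (S.alongV L) q + pderivCoord a (S.alongV M) q := by
  rw [← pderivCoord_add (differentiableAt (alongV_smooth hL) hq)
    (differentiableAt (alongV_smooth hM) hq)]
  exact congrArg (pderivCoord a · q) (funext fun x => alongV_add L M x)

lemma isKillingTensor_symCovDeriv_zero : S.IsKillingTensor (S.symCovDeriv (fun _ _ => 0)) :=
  IsKillingTensor.zero.congr fun q _ => symCovDeriv_zero q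

lemma isKillingTensor_symCovDeriv_smul {L : (Fin n → ℝ) → Fin n → ℝ}
    (hSL : S.IsKillingTensor (S.symCovDeriv L)) (c : ℝ) :
    S.IsKillingTensor (S.symCovDeriv (fun q a => c * L q a)) :=
  (hSL.smul c).congr fun q _ => symCovDeriv_smul c L q

lemma isKillingTensor_symCovDeriv_add {L M : (Fin n → ℝ) → Fin n → ℝ}
    (hL : S.IsCovectorField L) (hM : S.IsCovectorField M)
    (hSL : S.IsKillingTensor (S.symCovDeriv L)) (hSM : S.IsKillingTensor (S.symCovDeriv M)) :
    S.IsKillingTensor (S.symCovDeriv (fun q a => L q a + M q a)) :=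
  (hSL.add hSM).congr fun _ hq => symCovDeriv_add hL hM hq

lemma quadForm_symCovDeriv_zero (q v : Fin n → ℝ) :
    quadForm (S.symCovDeriv (fun _ _ => 0) q) v = 0 := by
  simp [quadForm, symCovDeriv_zero]

lemma contractV_symCovDeriv_zero (q : Fin n → ℝ) (a : Fin n) :
    S.contractV (S.symCovDeriv (fun _ _ => 0)) q a = 0 := by
  simp [contractV, symCovDeriv_zero]

lemma pderivCoord_alongV_zero (q : Fin n → ℝ) (a : Fin n) :
    pderivCoord a (S.alongV (fun _ _ => 0)) q = 0 := by
  simp [alongV_zero, pderivCoord]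

/-- Supplies the type 3 pair when no exponentials occur. -/
lemma isData₃_zero {l : ℂ} (hl : l ≠ 0) : S.IsData₃ l (fun _ _ => 0) :=
  ⟨hl, IsCovectorField.zero, isKillingTensor_symCovDeriv_zero, fun q _ a => by
    simp [pderivCoord_alongV_zero, contractV_symCovDeriv_zero]⟩

/-- `I` is a sum of members of the three families on `T × U × ℝⁿ`. -/
def HasNormalForm (S : ConservativeSystem n) (T : Set ℝ)
    (I : ℝ → (Fin n → ℝ) → (Fin n → ℝ) → ℝ) : Prop :=
  ∃ (C₁ : (Fin n → ℝ) → Fin n → Fin n → ℝ) (L₁ : (Fin n → ℝ) → Fin n → ℝ)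
    (G : (Fin n → ℝ) → ℝ) (L₂ B₂ : (Fin n → ℝ) → Fin n → ℝ)
    (l : ℂ) (L₃ : (Fin n → ℝ) → Fin n → ℝ) (α β : ℂ),
    S.IsData₁ C₁ L₁ G ∧ S.IsData₂ L₂ B₂ ∧ S.IsData₃ l L₃ ∧ S.IsData₃ (-l) L₃ ∧
    ((l.im = 0 ∧ α.im = 0 ∧ β.im = 0) ∨ (l.re = 0 ∧ β = starRingEnd ℂ α)) ∧
    ∀ t ∈ T, ∀ q ∈ S.U, ∀ v : Fin n → ℝ,
      ((I t q v : ℝ) : ℂ) =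
        ((S.I₁ C₁ L₁ G t q v : ℝ) : ℂ) + ((S.I₂ L₂ B₂ t q v : ℝ) : ℂ)
          + α * S.I₃ l L₃ t q v + β * S.I₃ (-l) L₃ t q v

section Ansatz

variable {g f : ℝ → ℝ} {C : (Fin n → ℝ) → Fin n → Fin n → ℝ}
  {L B : (Fin n → ℝ) → Fin n → ℝ} {K : ℝ → (Fin n → ℝ) → ℝ}

/-- Here f = (b/2) t² + c₁ t + c₀. The t² part of f L + B goes to type 2, the t part to type 1, and
the static part B + c₀ L to type 2. -/
lemma DeterminingEquations.hasNormalForm_of_deriv_deriv_const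
    (h : S.DeterminingEquations T g f C L B K)
    (hT : IsOpen T) (hconn : T.OrdConnected) (hne : T.Nonempty) (hg : AnalyticOnNhd ℝ g T)
    (hf : AnalyticOnNhd ℝ f T)
    (hC : S.IsKillingTensor C) (hL : S.IsCovectorField L) (hB : S.IsCovectorField B)
    (hSL : S.IsKillingTensor (S.symCovDeriv L)) (hSB : S.IsKillingTensor (S.symCovDeriv B))
    (hK : ContDiffOn ℝ ∞ (fun p : ℝ × (Fin n → ℝ) => K p.1 p.2) (T ×ˢ S.U))
    {b : ℝ} (hfb : ∀ t ∈ T, deriv (deriv f) t = b)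
    (hLa : ∀ q ∈ S.U, ∀ i, pderivCoord i (S.alongV L) q
      = -2 * S.contractV (S.symCovDeriv L) q i)
    (hBb : ∀ q ∈ S.U, ∀ i, pderivCoord i (S.alongV B) q
      = -2 * S.contractV (S.symCovDeriv B) q i - b * L q i) :
    S.HasNormalForm T (ansatz g f C L B K) := by
  obtain ⟨t₀, ht₀⟩ := id hne
  obtain ⟨c₁, hc₁⟩ : ∃ c₁, ∀ t ∈ T, deriv f t = b * t + c₁ := by
    refine ⟨deriv f t₀ - b * t₀, fun t ht => ?_⟩
    have := eq_of_hasDerivAt_zero hT hconn (φ := fun t => deriv f t - b * t) (fun r hr =>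
      ((hf.deriv r hr).differentiableAt.hasDerivAt.fun_sub
        ((hasDerivAt_id' r).const_mul b)).congr_deriv (by rw [hfb r hr]; ring)) ht ht₀
    linear_combination this
  obtain ⟨c₀, hc₀⟩ : ∃ c₀, ∀ t ∈ T, f t = b / 2 * t ^ 2 + c₁ * t + c₀ := by
    refine ⟨f t₀ - (b / 2 * t₀ ^ 2 + c₁ * t₀), fun t ht => ?_⟩
    have := eq_of_hasDerivAt_zero hT hconn (φ := fun t => f t - (b / 2 * t ^ 2 + c₁ * t))
      (fun r hr => ((hf r hr).differentiableAt.hasDerivAt.fun_sub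
        ((((hasDerivAt_id' r).fun_pow 2).const_mul (b / 2)).fun_add
          ((hasDerivAt_id' r).const_mul c₁))).congr_deriv
            (by rw [hc₁ r hr]; norm_num; ring)) ht ht₀
    linear_combination this
  have hp : ∀ t ∈ T,
      HasDerivAt (fun t => b / 6 * t ^ 3 + c₁ / 2 * t ^ 2 + c₀ * t) (f t) t := by
    intro t ht
    have d0 := hasDerivAt_id' t
    refine ((((d0.fun_pow 3).const_mul (b / 6)).fun_add
      ((d0.fun_pow 2).const_mul (c₁ / 2))).fun_add (d0.const_mul c₀)).congr_deriv ?_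
    rw [hc₀ t ht]
    norm_num
    ring
  -- With a = 0 the coefficient b t - f' in the gradient of G is the constant -c₁, as type 1
  -- requires for the field c₁ L.
  obtain ⟨C₁, G, hC₁, hG, hGi, hans⟩ := h.exists_static_parts hT hconn hne hg hC hL hB hSL hSB hK
    (a := 0) (b := b) (fun q hq i => by rw [hLa q hq]; ring) hBb hp
  refine ⟨C₁, fun q i => c₁ * L q i, G, fun q i => b / 2 * L q i,
    fun q i => B q i + c₀ * L q i, 1, fun _ _ => 0, 0, 0, ?_, ?_, isData₃_zero one_ne_zero,
    isData₃_zero (neg_ne_zero.2 one_ne_zero), by simp, fun t ht q hq v => ?_⟩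
  · refine ⟨hL.smul _, hG, hC₁, isKillingTensor_symCovDeriv_smul hSL _, fun q hq i => ?_,
      fun q hq i => ?_⟩
    · rw [pderivCoord_alongV_smul, contractV_symCovDeriv_smul, hLa q hq]
      ring
    · rw [hGi t₀ ht₀ q hq, hc₁ t₀ ht₀]
      ring
  · refine ⟨hL.smul _, hB.add (hL.smul _), isKillingTensor_symCovDeriv_smul hSL _,
      isKillingTensor_symCovDeriv_add hB (hL.smul _) hSB (isKillingTensor_symCovDeriv_smul hSL _),
      fun q hq i => ?_, fun q hq i => ?_⟩
    · rw [pderivCoord_alongV_smul, contractV_symCovDeriv_smul, hLa q hq]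
      ring
    · rw [pderivCoord_alongV_add hB (hL.smul _) hq, contractV_symCovDeriv_add hB (hL.smul _) hq,
        pderivCoord_alongV_smul, contractV_symCovDeriv_smul, hLa q hq, hBb q hq]
      ring
  · rw [zero_mul, zero_mul, add_zero, add_zero, ← Complex.ofReal_add, hans t ht q hq v, I₁, I₂,
      quadForm_symCovDeriv_smul, quadForm_symCovDeriv_smul,
      quadForm_symCovDeriv_add hB (hL.smul _) hq, quadForm_symCovDeriv_smul, linForm_smul,
      linForm_smul, linForm_add, linForm_smul, alongV_smul, alongV_smul, alongV_add, alongV_smul,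
      hc₀ t ht]
    congr 1
    ring

/-- The shifted function f + b/a solves the homogeneous equation u'' = a u; the shift is absorbed
into the static covector B - (b/a) L. -/
lemma DeterminingEquations.hasNormalForm_of_deriv_deriv_eq
    (h : S.DeterminingEquations T g f C L B K)
    (hT : IsOpen T) (hconn : T.OrdConnected) (hne : T.Nonempty) (hg : AnalyticOnNhd ℝ g T)
    (hf : AnalyticOnNhd ℝ f T)
    (hC : S.IsKillingTensor C) (hL : S.IsCovectorField L) (hB : S.IsCovectorField B)
    (hSL : S.IsKillingTensor (S.symCovDeriv L)) (hSB : S.IsKillingTensor (S.symCovDeriv B))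
    (hK : ContDiffOn ℝ ∞ (fun p : ℝ × (Fin n → ℝ) => K p.1 p.2) (T ×ˢ S.U))
    {a b : ℝ} (ha : a ≠ 0) (hfab : ∀ t ∈ T, deriv (deriv f) t = a * f t + b)
    (hLa : ∀ q ∈ S.U, ∀ i, pderivCoord i (S.alongV L) q
      = -2 * S.contractV (S.symCovDeriv L) q i - a * L q i)
    (hBb : ∀ q ∈ S.U, ∀ i, pderivCoord i (S.alongV B) q
      = -2 * S.contractV (S.symCovDeriv B) q i - b * L q i) :
    S.HasNormalForm T (ansatz g f C L B K) := by
  obtain ⟨t₀, ht₀⟩ := id hne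
  have hf' : ∀ t ∈ T, HasDerivAt (fun t => deriv f t / a) (f t + b / a) t := fun t ht =>
    ((hf.deriv t ht).differentiableAt.hasDerivAt.div_const a).congr_deriv (by
      rw [hfab t ht]
      field_simp)
  -- For this primitive a p + b t - f' = 0, so the gradient of G has no term in L and type 1 takes
  -- the zero covector.
  have hp : ∀ t ∈ T, HasDerivAt (fun t => deriv f t / a - b / a * t) (f t) t := fun t ht =>
    ((hf' t ht).fun_sub ((hasDerivAt_id' t).const_mul (b / a))).congr_deriv (by ring)
  obtain ⟨l, α, β, hl, hla, hreal, hexp⟩ := exists_exp_coefficients hT hconn hne ha hf'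
    (fun t ht => ((hf t ht).differentiableAt.hasDerivAt.add_const (b / a)).congr_deriv
      (by field_simp))
  obtain ⟨C₁, G, hC₁, hG, hGi, hans⟩ := h.exists_static_parts hT hconn hne hg hC hL hB hSL hSB hK
    hLa hBb hp
  have hdata : ∀ m : ℂ, m ≠ 0 → m ^ 2 = a → S.IsData₃ m L := fun m hm hma =>
    ⟨hm, hL, hSL, fun q hq i => by
      rw [hLa q hq, hma]
      push_cast
      ring⟩
  refine ⟨C₁, fun _ _ => 0, G, fun _ _ => 0, fun q i => B q i + (-(b / a)) * L q i, l, L, α, β,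
    ?_, ?_, hdata l hl hla, hdata (-l) (neg_ne_zero.2 hl) (by rw [neg_sq, hla]), hreal,
    fun t ht q hq v => ?_⟩
  · refine ⟨IsCovectorField.zero, hG, hC₁, isKillingTensor_symCovDeriv_zero, fun q hq i => ?_,
      fun q hq i => ?_⟩
    · rw [pderivCoord_alongV_zero, contractV_symCovDeriv_zero, mul_zero]
    · rw [hGi t₀ ht₀ q hq]
      field_simp
      ring
  · refine ⟨IsCovectorField.zero, hB.add (hL.smul _), isKillingTensor_symCovDeriv_zero,
      isKillingTensor_symCovDeriv_add hB (hL.smul _) hSB (isKillingTensor_symCovDeriv_smul hSL _),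
      fun q hq i => ?_, fun q hq i => ?_⟩
    · rw [pderivCoord_alongV_zero, contractV_symCovDeriv_zero, mul_zero]
    · rw [pderivCoord_alongV_add hB (hL.smul _) hq, contractV_symCovDeriv_add hB (hL.smul _) hq,
        pderivCoord_alongV_smul, contractV_symCovDeriv_smul, hLa q hq, hBb q hq]
      field_simp
      ring
  · obtain ⟨e1, e2⟩ := hexp t ht
    have z : ∀ v : Fin n → ℝ, linForm (fun _ => 0) v = 0 := fun v => by simp [linForm]
    rw [hans t ht q hq v, I₁, I₂, I₃, I₃, quadForm_symCovDeriv_zero,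
      quadForm_symCovDeriv_add hB (hL.smul _) hq, quadForm_symCovDeriv_smul, linForm_add,
      linForm_smul, alongV_add, alongV_smul, z, alongV_zero]
    push_cast at e1 e2 ⊢
    linear_combination ((quadForm (S.symCovDeriv L q) v : ℂ) - (S.alongV L q : ℂ)) * e1
      - (linForm (L q) v : ℂ) * e2

/-- The normal form when the linear part does not depend on time. -/
lemma DeterminingEquations.hasNormalForm_of_static
    (h : S.DeterminingEquations T g (fun _ => 0) C (fun _ _ => 0) B K)
    (hT : IsOpen T) (hconn : T.OrdConnected) (hne : T.Nonempty) (hg : AnalyticOnNhd ℝ g T)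
    (hC : S.IsKillingTensor C) (hB : S.IsCovectorField B)
    (hK : ContDiffOn ℝ ∞ (fun p : ℝ × (Fin n → ℝ) => K p.1 p.2) (T ×ˢ S.U)) :
    S.HasNormalForm T (ansatz g (fun _ => 0) C (fun _ _ => 0) B K) := by
  obtain ⟨t₀, ht₀⟩ := id hne
  have hf : AnalyticOnNhd ℝ (fun _ : ℝ => (0 : ℝ)) T := analyticOnNhd_const
  -- With f = 0 the quadratic equation makes B_(i;j) a constant multiple of C.
  have hSB : S.IsKillingTensor (S.symCovDeriv B) :=
    (hC.smul (-deriv g t₀)).congr fun q hq i j => by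
      linear_combination h.quadratic t₀ ht₀ q hq i j
  refine h.hasNormalForm_of_deriv_deriv_const hT hconn hne hg hf hC IsCovectorField.zero hB
    isKillingTensor_symCovDeriv_zero hSB hK (b := 0) (fun t _ => by simp) (fun q _ i => ?_)
    (fun q hq i => ?_)
  · rw [pderivCoord_alongV_zero, contractV_symCovDeriv_zero, mul_zero]
  · linear_combination h.integrability hT hconn hg hf IsCovectorField.zero hB hK ht₀ hq i

lemma HasNormalForm.congr {I I' : ℝ → (Fin n → ℝ) → (Fin n → ℝ) → ℝ}
    (hI : S.HasNormalForm T I) (h : ∀ t ∈ T, ∀ q ∈ S.U, ∀ v, I' t q v = I t q v) :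
    S.HasNormalForm T I' := by
  obtain ⟨C₁, L₁, G, L₂, B₂, l, L₃, α, β, h1, h2, h3, h4, h5, h6⟩ := hI
  exact ⟨C₁, L₁, G, L₂, B₂, l, L₃, α, β, h1, h2, h3, h4, h5, fun t ht q hq v => by
    rw [h t ht q hq v, h6 t ht q hq v]⟩

/-- Solutions on subsets of `T` only see values over `T` and `S.U`. -/
lemma IsFirstIntegral.congr {I I' : ℝ → (Fin n → ℝ) → (Fin n → ℝ) → ℝ}
    (hI : S.IsFirstIntegral T I) (h : ∀ t ∈ T, ∀ q ∈ S.U, ∀ v, I' t q v = I t q v) :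
    S.IsFirstIntegral T I' := by
  intro J hJ hJT q v hsol t ht
  refine (hI J hJ hJT q v hsol t ht).congr_of_eventuallyEq ?_
  exact Filter.eventuallyEq_of_mem (hJ.mem_nhds ht) fun s hs =>
    h s (hJT hs) (q s) (hsol s hs).1 (v s)

/-- The normal form when `f L + B` is independent of time. -/
lemma IsFirstIntegral.hasNormalForm_of_linear_part_static
    (hI : S.IsFirstIntegral T (ansatz g f C L B K))
    (hT : IsOpen T) (hconn : T.OrdConnected) (hne : T.Nonempty) (hg : AnalyticOnNhd ℝ g T)
    (hC : S.IsKillingTensor C)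
    (hK : ContDiffOn ℝ ∞ (fun p : ℝ × (Fin n → ℝ) => K p.1 p.2) (T ×ˢ S.U))
    {B' : (Fin n → ℝ) → Fin n → ℝ} (hB' : S.IsCovectorField B')
    (h : ∀ t ∈ T, ∀ q ∈ S.U, ∀ i, f t * L q i + B q i = B' q i) :
    S.HasNormalForm T (ansatz g f C L B K) := by
  have heq : ∀ t ∈ T, ∀ q ∈ S.U, ∀ v,
      ansatz g (fun _ => 0) C (fun _ _ => 0) B' K t q v = ansatz g f C L B K t q v := by
    intro t ht q hq v
    have : f t * linForm (L q) v + linForm (B q) v = linForm (B' q) v := by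
      rw [← linForm_smul, ← linForm_add]
      exact congrArg (linForm · v) (funext fun i => h t ht q hq i)
    simp only [ansatz, this]
    ring
  refine HasNormalForm.congr ?_ fun t ht q hq v => (heq t ht q hq v).symm
  exact ((hI.congr heq).determiningEquations hT hg analyticOnNhd_const hC IsCovectorField.zero hB'
    hK).hasNormalForm_of_static hT hconn hne hg hC hB' hK

theorem IsFirstIntegral.hasNormalForm (hI : S.IsFirstIntegral T (ansatz g f C L B K))
    (hT : IsOpen T) (hconn : T.OrdConnected) (hne : T.Nonempty) (hg : AnalyticOnNhd ℝ g T)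
    (hf : AnalyticOnNhd ℝ f T) (hC : S.IsKillingTensor C) (hL : S.IsCovectorField L)
    (hB : S.IsCovectorField B)
    (hK : ContDiffOn ℝ ∞ (fun p : ℝ × (Fin n → ℝ) => K p.1 p.2) (T ×ˢ S.U)) :
    S.HasNormalForm T (ansatz g f C L B K) := by
  obtain ⟨t₀, ht₀⟩ := id hne
  by_cases hconst : ∃ s ∈ T, ∃ t ∈ T, f s ≠ f t
  swap
  -- Constant f: its value at `t₀` is absorbed into the static covector.
  · push Not at hconst
    exact hI.hasNormalForm_of_linear_part_static hT hconn hne hg hC hK ((hL.smul (f t₀)).add hB)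
      fun t ht q _ i => by rw [hconst t ht t₀ ht₀]
  have hdet := hI.determiningEquations hT hg hf hC hL hB hK
  have hint : ∀ q ∈ S.U, ∀ i, ∀ t ∈ T, _ := fun q hq i t ht =>
    hdet.integrability hT hconn hg hf hL hB hK ht hq i
  rcases affine_or_independent (w := deriv (deriv f)) hconst with ⟨a, b, hab⟩ | hind
  swap
  -- Independence of f'', f, 1 forces L = 0 on `S.U`.
  · exact hI.hasNormalForm_of_linear_part_static hT hconn hne hg hC hK hB fun t ht q hq i => by
      rw [(hind _ _ _ (hint q hq i)).1, mul_zero, zero_add]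
  have hEF : ∀ q ∈ S.U, ∀ i,
      pderivCoord i (S.alongV L) q = -2 * S.contractV (S.symCovDeriv L) q i - a * L q i ∧
      pderivCoord i (S.alongV B) q = -2 * S.contractV (S.symCovDeriv B) q i - b * L q i := by
    intro q hq i
    obtain ⟨s, hs, t, ht, hst⟩ := hconst
    have e1 := hint q hq i s hs
    have e2 := hint q hq i t ht
    rw [hab s hs] at e1
    rw [hab t ht] at e2
    have e3 : (pderivCoord i (S.alongV L) q + 2 * S.contractV (S.symCovDeriv L) q i + a * L q i)
        * (f s - f t) = 0 := by linear_combination e1 - e2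
    have e4 := (mul_eq_zero.1 e3).resolve_right (sub_ne_zero.2 hst)
    exact ⟨by linear_combination e4, by linear_combination e1 - f s * e4⟩
  -- The quadratic equation is a relation between g', f, 1: either both symmetrized derivatives are
  -- constant multiples of C, or all its coefficients vanish.
  obtain ⟨hSL, hSB⟩ : S.IsKillingTensor (S.symCovDeriv L) ∧
      S.IsKillingTensor (S.symCovDeriv B) := by
    rcases affine_or_independent (w := deriv g) hconst with ⟨x, y, hxy⟩ | hind
    · have key : ∀ q ∈ S.U, ∀ i j, S.symCovDeriv L q i j = -x * C q i j ∧
          S.symCovDeriv B q i j = -y * C q i j := by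
        intro q hq i j
        obtain ⟨s, hs, t, ht, hst⟩ := hconst
        have e1 := hdet.quadratic s hs q hq i j
        have e2 := hdet.quadratic t ht q hq i j
        rw [hxy s hs] at e1
        rw [hxy t ht] at e2
        have e3 : (x * C q i j + S.symCovDeriv L q i j) * (f s - f t) = 0 := by
          linear_combination e1 - e2
        have e4 := (mul_eq_zero.1 e3).resolve_right (sub_ne_zero.2 hst)
        exact ⟨by linear_combination e4, by linear_combination e1 - f s * e4⟩
      exact ⟨(hC.smul (-x)).congr fun q hq i j => (key q hq i j).1,
        (hC.smul (-y)).congr fun q hq i j => (key q hq i j).2⟩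
    · have key : ∀ q ∈ S.U, ∀ i j, S.symCovDeriv L q i j = 0 ∧ S.symCovDeriv B q i j = 0 :=
        fun q hq i j => (hind (C q i j) _ _ fun t ht => by
          linear_combination hdet.quadratic t ht q hq i j).2
      exact ⟨IsKillingTensor.zero.congr fun q hq i j => (key q hq i j).1,
        IsKillingTensor.zero.congr fun q hq i j => (key q hq i j).2⟩
  by_cases ha : a = 0
  · subst ha
    exact hdet.hasNormalForm_of_deriv_deriv_const hT hconn hne hg hf hC hL hB hSL hSB hK (b := b)
      (fun t ht => by rw [hab t ht]; ring) (fun q hq i => by rw [(hEF q hq i).1]; ring)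
      (fun q hq i => (hEF q hq i).2)
  · exact hdet.hasNormalForm_of_deriv_deriv_eq hT hconn hne hg hf hC hL hB hSL hSB hK ha hab
      (fun q hq i => (hEF q hq i).1) (fun q hq i => (hEF q hq i).2)

end Ansatz

/-- Members of the three families are linearly independent over each fixed `q`. -/
lemma families_independent (hT : IsOpen T) (hne : T.Nonempty)
    {C₁ : (Fin n → ℝ) → Fin n → Fin n → ℝ} {L₁ : (Fin n → ℝ) → Fin n → ℝ}
    {G : (Fin n → ℝ) → ℝ} {L₂ B₂ : (Fin n → ℝ) → Fin n → ℝ}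
    {A : Finset ℂ} (hA : ∀ l ∈ A, l ≠ 0) {L₃ : ℂ → (Fin n → ℝ) → Fin n → ℝ} {α : ℂ → ℂ}
    {q : Fin n → ℝ}
    (h : ∀ t ∈ T, ∀ v : Fin n → ℝ,
      ((S.I₁ C₁ L₁ G t q v : ℝ) : ℂ) + ((S.I₂ L₂ B₂ t q v : ℝ) : ℂ)
        + ∑ l ∈ A, α l * S.I₃ l (L₃ l) t q v = 0) (t : ℝ) (v : Fin n → ℝ) :
    S.I₁ C₁ L₁ G t q v = 0 ∧ S.I₂ L₂ B₂ t q v = 0 ∧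
      ∀ l ∈ A, α l * S.I₃ l (L₃ l) t q v = 0 := by
  -- For fixed v, types 1 and 2 together form a cubic polynomial in t.
  have h3 : ∀ v : Fin n → ℝ, ∀ l ∈ A, α l * (-((quadForm (S.symCovDeriv (L₃ l) q) v : ℝ) : ℂ)
      + l * ((linForm (L₃ l q) v : ℝ) : ℂ) + ((S.alongV (L₃ l) q : ℝ) : ℂ)) = 0 := by
    intro v
    refine exp_coefficients_eq_zero hT hne hA
      (p₀ := ((quadForm (C₁ q) v + linForm (B₂ q) v + G q : ℝ) : ℂ))
      (p₁ := ((linForm (L₁ q) v - quadForm (S.symCovDeriv B₂ q) v + S.alongV B₂ q : ℝ) : ℂ))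
      (p₂ := ((-(1 / 2) * quadForm (S.symCovDeriv L₁ q) v + linForm (L₂ q) v
        + 1 / 2 * S.alongV L₁ q : ℝ) : ℂ))
      (p₃ := ((-(1 / 3) * quadForm (S.symCovDeriv L₂ q) v + 1 / 3 * S.alongV L₂ q : ℝ) : ℂ))
      fun t ht => ?_
    rw [← h t ht v, I₁, I₂]
    congr 1
    · push_cast
      ring
    · exact Finset.sum_congr rfl fun l _ => by rw [I₃]; ring
  have h3' : ∀ t : ℝ, ∀ v, ∀ l ∈ A, α l * S.I₃ l (L₃ l) t q v = 0 := by
    intro t v l hl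
    rw [I₃]
    linear_combination Complex.exp (l * t) * h3 v l hl
  have hpoly : ∀ v, quadForm (C₁ q) v + linForm (B₂ q) v + G q = 0 ∧
      linForm (L₁ q) v - quadForm (S.symCovDeriv B₂ q) v + S.alongV B₂ q = 0 ∧
      -(1 / 2) * quadForm (S.symCovDeriv L₁ q) v + linForm (L₂ q) v
        + 1 / 2 * S.alongV L₁ q = 0 ∧
      -(1 / 3) * quadForm (S.symCovDeriv L₂ q) v + 1 / 3 * S.alongV L₂ q = 0 := by
    intro v
    refine cubic_coefficients_eq_zero hT hne fun t ht => ?_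
    have := h t ht v
    rw [Finset.sum_eq_zero (h3' t v), add_zero, ← Complex.ofReal_add, Complex.ofReal_eq_zero, I₁,
      I₂] at this
    rw [← this]
    ring
  -- Types 1 and 2 share powers of t, but where they do, their velocity-dependent terms have
  -- opposite parity; the values at v, -v and 0 separate all terms.
  obtain ⟨a0, a1, a2, a3⟩ := hpoly v
  obtain ⟨b0, b1, b2, b3⟩ := hpoly (-v)
  obtain ⟨c0, c1, c2, c3⟩ := hpoly 0
  simp only [quadForm_neg_right, linForm_neg_right] at b0 b1 b2 b3
  simp only [quadForm_zero_right, linForm_zero_right] at c0 c1 c2 c3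
  refine ⟨?_, ?_, h3' t v⟩
  · have e1 : G q = 0 := by linarith
    have e2 : S.alongV L₁ q = 0 := by linarith
    have e3 : linForm (L₁ q) v = 0 := by linarith
    have e4 : quadForm (C₁ q) v = 0 := by linarith
    have e5 : quadForm (S.symCovDeriv L₁ q) v = 0 := by linarith
    rw [I₁, e1, e2, e3, e4, e5]
    ring
  · have e1 : S.alongV L₂ q = 0 := by linarith
    have e2 : S.alongV B₂ q = 0 := by linarith
    have e3 : linForm (L₂ q) v = 0 := by linarith
    have e4 : linForm (B₂ q) v = 0 := by linarith
    have e5 : quadForm (S.symCovDeriv L₂ q) v = 0 := by linarith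
    have e6 : quadForm (S.symCovDeriv B₂ q) v = 0 := by linarith
    rw [I₂, e1, e2, e3, e4, e5, e6]
    ring

end ConservativeSystem

theorem mainTheorem1 {n : ℕ} (S : ConservativeSystem n)
    (T : Set ℝ) (hT : IsOpen T) (hT_conn : T.OrdConnected) (hT_ne : T.Nonempty) :
    -- the three families consist of first integrals
    (∀ (C : (Fin n → ℝ) → Fin n → Fin n → ℝ) (L : (Fin n → ℝ) → Fin n → ℝ)
        (G : (Fin n → ℝ) → ℝ),
      S.IsData₁ C L G → S.IsFirstIntegral T (S.I₁ C L G)) ∧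
    (∀ L B : (Fin n → ℝ) → Fin n → ℝ,
      S.IsData₂ L B → S.IsFirstIntegral T (S.I₂ L B)) ∧
    (∀ (l : ℂ) (L : (Fin n → ℝ) → Fin n → ℝ),
      S.IsData₃ l L → S.IsFirstIntegral T (S.I₃ l L)) ∧
    -- every first integral of the assumed form is a sum of members of the three families
    (∀ (g f : ℝ → ℝ) (C : (Fin n → ℝ) → Fin n → Fin n → ℝ)
        (L B : (Fin n → ℝ) → Fin n → ℝ) (K : ℝ → (Fin n → ℝ) → ℝ),
      AnalyticOnNhd ℝ g T → AnalyticOnNhd ℝ f T → S.IsKillingTensor C →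
      S.IsCovectorField L → S.IsCovectorField B →
      ContDiffOn ℝ ∞ (fun p : ℝ × (Fin n → ℝ) => K p.1 p.2) (T ×ˢ S.U) →
      S.IsFirstIntegral T (ConservativeSystem.ansatz g f C L B K) →
      ∃ (C₁ : (Fin n → ℝ) → Fin n → Fin n → ℝ) (L₁ : (Fin n → ℝ) → Fin n → ℝ)
        (G : (Fin n → ℝ) → ℝ) (L₂ B₂ : (Fin n → ℝ) → Fin n → ℝ)
        (l : ℂ) (L₃ : (Fin n → ℝ) → Fin n → ℝ) (α β : ℂ),
        S.IsData₁ C₁ L₁ G ∧ S.IsData₂ L₂ B₂ ∧ S.IsData₃ l L₃ ∧ S.IsData₃ (-l) L₃ ∧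
        ((l.im = 0 ∧ α.im = 0 ∧ β.im = 0) ∨ (l.re = 0 ∧ β = starRingEnd ℂ α)) ∧
        ∀ t ∈ T, ∀ q ∈ S.U, ∀ v : Fin n → ℝ,
          ((ConservativeSystem.ansatz g f C L B K t q v : ℝ) : ℂ) =
            ((S.I₁ C₁ L₁ G t q v : ℝ) : ℂ) + ((S.I₂ L₂ B₂ t q v : ℝ) : ℂ)
              + α * S.I₃ l L₃ t q v + β * S.I₃ (-l) L₃ t q v) ∧
    -- members of different families are linearly independent
    (∀ (C₁ : (Fin n → ℝ) → Fin n → Fin n → ℝ) (L₁ : (Fin n → ℝ) → Fin n → ℝ)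
        (G : (Fin n → ℝ) → ℝ) (L₂ B₂ : (Fin n → ℝ) → Fin n → ℝ)
        (A : Finset ℂ) (L₃ : ℂ → (Fin n → ℝ) → Fin n → ℝ) (α : ℂ → ℂ),
      S.IsData₁ C₁ L₁ G → S.IsData₂ L₂ B₂ → (∀ l ∈ A, S.IsData₃ l (L₃ l)) →
      (∀ t ∈ T, ∀ q ∈ S.U, ∀ v : Fin n → ℝ,
        ((S.I₁ C₁ L₁ G t q v : ℝ) : ℂ) + ((S.I₂ L₂ B₂ t q v : ℝ) : ℂ)
          + ∑ l ∈ A, α l * S.I₃ l (L₃ l) t q v = 0) →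
      ∀ t ∈ T, ∀ q ∈ S.U, ∀ v : Fin n → ℝ,
        S.I₁ C₁ L₁ G t q v = 0 ∧ S.I₂ L₂ B₂ t q v = 0 ∧
          ∀ l ∈ A, α l * S.I₃ l (L₃ l) t q v = 0) := by
  refine ⟨fun C L G h => h.isFirstIntegral, fun L B h => h.isFirstIntegral,
    fun l L h => h.isFirstIntegral, ?_, ?_⟩
  · intro g f C L B K hg hf hC hL hB hK hI
    exact hI.hasNormalForm hT hT_conn hT_ne hg hf hC hL hB hK
  · intro C₁ L₁ G L₂ B₂ A L₃ α _ _ h₃ h t _ q hq v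
    exact ConservativeSystem.families_independent hT hT_ne (fun l hl => (h₃ l hl).l_ne_zero)
      (fun t ht v => h t ht q hq v) t v
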